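/- Let $G=(V,E)$ be a finite simple graph with nonnegative edge weights $w\in\mathbb{R}_+^E$, and let $\nu(G)$ be the maximum cardinality of a matching in $G$. Consider Edmonds' minimum-weight perfect matching algorithm in the following form. *State.* A laminar family $\Omega$ of odd subsets of $V$, with inclusion-wise maximal members $\Omega_{\max}$; dual values $\pi(U)\in\mathbb{R}$ for odd $U\subseteq V$; for each $U\in\Omega$ with $|U|\ge 3$ an odd circuit $C_U$; and a matching $M$ in the graph $G'$, whose node set is $\Omega_{\max}$ and whose edges are the edges $e\in E$ joining different members of $\Omega_{\max}$ with $\sum_{U:\,e\in\delta(U)}\pi(U)=w_e$. The dual constraints are $\pi(U)\ge 0$ for all odd $U$ with $|U|\ge3$, and $\sum_{U:\,e\in\delta(U)}\pi(U)\le w_e$ for all $e\in E$. Let $X\subseteq\Omega_{\max}$ be the set of nodes of $G'$ not covered by $M$. *Deshrinking* $U\in\Omega_{\max}$, $|U|\ge3$: remove $U$ from $\Omega$ and add to $M$ the perfect matching of $C_U-B$, where $B$ is the node of $C_U$ covered by $M$ (any node of $C_U$ if $M$ covers none). *Start.* $M=\emptyset$, $\pi=0$, $\Omega=\{\{v\}: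 v\in V\}$. *Iteration.* Stop with a perfect matching if $X=\emptyset$. Otherwise: 1. If $G'$ has an $M$-alternating walk of positive length from a node of $X$ to a node of $X$, do one of the following. Either augment $M$ along such a walk that is a path. Or take an $M$-flower, i.e. an $M$-alternating walk $v_0,\dots,v_t$ in $G'$ with $v_0\in X$, $t$ odd, $v_0,\dots,v_{t-1}$ distinct and $v_t=v_i$ for an even $i<t$, and shrink its blossom: add $U=v_i\cup\dots\cup v_{t-1}$ to $\Omega$, let $C_U$ be the circuit $v_i,\dots,v_t$, and remove the edges of $C_U$ from $M$. 2. If there is no such walk, let $\mathcal S$ (resp. $\mathcal T$) be the set of nodes of $G'$ reached by an odd-length (resp. even-length) $M$-alternating path starting in $X$. Decrease $\pi(U)$ by $\alpha$ for $U\in\mathcal S$ and increase it by $\alpha$ for $U\in\mathcal T$, where $\alpha$ is the largest value for which the dual constraints still hold. Then deshrink, one after another, sets $U\in\Omega_{\max}$ with $|U|\ge3$ and $\pi(U)=0$, among them all those whose value was decreased to $0$. If $\alpha$ can be chosen arbitrarily large, the algorithm instead stops and asserts that $G$ has no perfect matching. In any state, let $\widetilde M$ denote a set of edges of $G$ obtained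 from $M$ by iteratively deshrinking the sets of $\Omega_{\max}$ (regardless of their dual values) until all members of $\Omega$ are singletons. **Proposition.** In every run of the algorithm, for all choices it makes: when the algorithm asserts that $G$ has no perfect matching, such a set $\widetilde M$ exists, and every such $\widetilde M$ is a matching in $G$ of maximum cardinality, that is, $|\widetilde M|=\nu(G)$. -/

import Mathlib

namespace EdmondsMatching

variable {V : Type*}

/-- A set `M` of edges of `G` no two of which share a node. -/
def IsMatching (G : SimpleGraph V) (M : Finset (Sym2 V)) : Prop :=
  (∀ e ∈ M, e ∈ G.edgeSet) ∧
    ∀ e ∈ M, ∀ f ∈ M, ∀ v : V, v ∈ e → v ∈ f → e = f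

open Classical in
/-- The matching number `ν(G)`: the maximum cardinality of a matching in `G`. -/
noncomputable def matchingNumber [Fintype V] (G : SimpleGraph V) : ℕ :=
  (Finset.univ.filter fun M : Finset (Sym2 V) => IsMatching G M).sup Finset.card

/-- `e ∈ δ(U)`: exactly one end of `e` lies in `U`. -/
def InCut (e : Sym2 V) (U : Finset V) : Prop :=
  ∃ u v : V, e = s(u, v) ∧ u ∈ U ∧ v ∉ U

/-- The edge `e` has an end in the node set `A`. -/
def Touches (e : Sym2 V) (A : Finset V) : Prop :=
  ∃ v ∈ e, v ∈ A

/-- The edge `e` has one end in `A` and the other end in `B`. -/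
def Joins (e : Sym2 V) (A B : Finset V) : Prop :=
  ∃ a ∈ A, ∃ b ∈ B, e = s(a, b)

open Classical in
/-- `∑ π(U)` over all odd sets `U` with `e ∈ δ(U)`. -/
noncomputable def cutSum [Fintype V] (π : Finset V → ℝ) (e : Sym2 V) : ℝ :=
  ∑ U ∈ Finset.univ.filter (fun U : Finset V => Odd U.card ∧ InCut e U), π U

/-- The two families of constraints on the dual variables. -/
def DualFeasible [Fintype V] (G : SimpleGraph V) (w : Sym2 V → ℝ) (π : Finset V → ℝ) : Prop :=
  (∀ U : Finset V, Odd U.card → 3 ≤ U.card → 0 ≤ π U) ∧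
    ∀ e ∈ G.edgeSet, cutSum π e ≤ w e

/-- The raw data of a walk of length `len` whose nodes are node sets of `G`: it visits
`node 0, …, node len` and `edge i`, an edge of `G`, leads from `node i` to `node (i + 1)`.
A circuit is such a walk with `node len = node 0`. Values at larger indices are irrelevant. -/
structure Walk (V : Type*) where
  len : ℕ
  node : ℕ → Finset V
  edge : ℕ → Sym2 V

namespace Walk

/-- The set of edges of a walk. -/
def edges [DecidableEq V] (P : Walk V) : Finset (Sym2 V) :=
  (Finset.range P.len).image P.edge

/-- All nodes of the walk are distinct. -/
def IsPath (P : Walk V) : Prop :=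
  ∀ i ≤ P.len, ∀ j ≤ P.len, P.node i = P.node j → i = j

end Walk

/-- A state of the algorithm: the current matching `M` of the shrunken graph (each edge of the
shrunken graph is represented by the edge of `G` it stems from), the laminar family `Ω`, the dual
variables `π`, and for each shrunken set `U ∈ Ω` the odd circuit `circ U` that was shrunk to
obtain `U` (`none` for sets that have never been shrunk). -/
structure State (V : Type*) where
  M : Finset (Sym2 V)
  Ω : Finset (Finset V)
  π : Finset V → ℝ
  circ : Finset V → Option (Walk V)

namespace State

/-- `Ω_max`, the inclusion-wise maximal members of `Ω`; these are the nodes of `G'`. -/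
def maxSets (s : State V) : Set (Finset V) :=
  {U | Maximal (· ∈ s.Ω) U}

/-- `e` is an edge of `G'` with ends `A` and `B`: it is an edge of `G` whose dual constraint is
tight, and it joins the two distinct nodes `A` and `B` of `G'`. -/
def Link [Fintype V] (G : SimpleGraph V) (w : Sym2 V → ℝ) (s : State V)
    (e : Sym2 V) (A B : Finset V) : Prop :=
  e ∈ G.edgeSet ∧ cutSum s.π e = w e ∧ A ∈ s.maxSets ∧ B ∈ s.maxSets ∧ A ≠ B ∧ Joins e A B

/-- The set `X` of nodes of `G'` that are not covered by `M`. -/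
def exposed (s : State V) : Set (Finset V) :=
  {U | U ∈ s.maxSets ∧ ∀ e ∈ s.M, ¬ Touches e U}

/-- `P` is an `M`-alternating walk in `G'`: of any two consecutive edges exactly one is in `M`. -/
def IsAlternating [Fintype V] (G : SimpleGraph V) (w : Sym2 V → ℝ) (s : State V)
    (P : Walk V) : Prop :=
  (∀ i < P.len, s.Link G w (P.edge i) (P.node i) (P.node (i + 1))) ∧
    ∀ i, i + 1 < P.len → (P.edge i ∈ s.M ↔ P.edge (i + 1) ∉ s.M)

/-- `P` is an `M`-alternating walk of positive length in `G'` from a node in `X` to a node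
in `X`. -/
def IsXXWalk [Fintype V] (G : SimpleGraph V) (w : Sym2 V → ℝ) (s : State V)
    (P : Walk V) : Prop :=
  s.IsAlternating G w P ∧ 0 < P.len ∧ P.node 0 ∈ s.exposed ∧ P.node P.len ∈ s.exposed

/-- `P` is an `M`-flower in `G'` with blossom starting at index `i`: an `M`-alternating walk of odd
length `t` that starts in `X`, whose first `t` nodes are distinct, and whose last node equals
the `i`-th node for some even `i < t`. The part from index `i` on is the blossom. -/
def IsFlower [Fintype V] (G : SimpleGraph V) (w : Sym2 V → ℝ) (s : State V)
    (P : Walk V) (i : ℕ) : Prop :=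
  s.IsAlternating G w P ∧ P.node 0 ∈ s.exposed ∧ Odd P.len ∧ Even i ∧ i < P.len ∧
    P.node P.len = P.node i ∧
    ∀ j < P.len, ∀ k < P.len, P.node j = P.node k → j = k

/-- The nodes of `G'` that an `M`-alternating path starting in `X` reaches in an odd number of
steps. -/
def oddReach [Fintype V] (G : SimpleGraph V) (w : Sym2 V → ℝ) (s : State V) : Set (Finset V) :=
  {U | U ∈ s.maxSets ∧ ∃ P : Walk V, s.IsAlternating G w P ∧ P.IsPath ∧
    P.node 0 ∈ s.exposed ∧ P.node P.len = U ∧ Odd P.len}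

/-- The nodes of `G'` that an `M`-alternating path starting in `X` reaches in an even number of
steps (possibly zero). -/
def evenReach [Fintype V] (G : SimpleGraph V) (w : Sym2 V → ℝ) (s : State V) : Set (Finset V) :=
  {U | U ∈ s.maxSets ∧ ∃ P : Walk V, s.IsAlternating G w P ∧ P.IsPath ∧
    P.node 0 ∈ s.exposed ∧ P.node P.len = U ∧ Even P.len}

open Classical in
/-- The dual variables after a change by `α`: decreased on `𝒮`, increased on `𝒯`. -/
noncomputable def shiftDual [Fintype V] (G : SimpleGraph V) (w : Sym2 V → ℝ) (s : State V)
    (α : ℝ) : Finset V → ℝ := fun U =>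
  s.π U - (if U ∈ s.oddReach G w then α else 0) + (if U ∈ s.evenReach G w then α else 0)

/-- The step sizes `α` for which the changed dual variables satisfy the dual constraints. -/
def stepSizes [Fintype V] (G : SimpleGraph V) (w : Sym2 V → ℝ) (s : State V) : Set ℝ :=
  {α | DualFeasible G w (s.shiftDual G w α)}

end State

/-- The blossom of a flower, as a circuit. -/
def blossom (P : Walk V) (i : ℕ) : Walk V where
  len := P.len - i
  node := fun j => P.node (i + j)
  edge := fun j => P.edge (i + j)

/-- The union of the nodes of the blossom. -/
def blossomSet [DecidableEq V] (P : Walk V) (i : ℕ) : Finset V :=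
  (Finset.Ico i P.len).biUnion P.node

/-- The initial state: `M = ∅`, `Ω` consists of the singletons, `π = 0`, no circuits. -/
def initial (V : Type*) [Fintype V] [DecidableEq V] : State V where
  M := ∅
  Ω := Finset.univ.image fun v : V => {v}
  π := fun _ => 0
  circ := fun _ => none

/-- `N` is a perfect matching of the circuit `C` minus its node `B`. -/
def IsNearPerfect [DecidableEq V] (C : Walk V) (B : Finset V) (N : Finset (Sym2 V)) : Prop :=
  N ⊆ C.edges ∧ (∀ e ∈ N, ¬ Touches e B) ∧
    ∀ j < C.len, C.node j ≠ B → ∃! e, e ∈ N ∧ Touches e (C.node j)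

/-- `t` arises from `s` by deshrinking the set `U ∈ Ω_max`, `|U| ≥ 3`: `U` is removed from `Ω`, and
`M` is extended by a perfect matching of the circuit of `U` minus a node `B`, where `B` is the
node of the circuit covered by `M`, if there is one. -/
def Deshrink [DecidableEq V] (s : State V) (U : Finset V) (t : State V) : Prop :=
  U ∈ s.maxSets ∧ 3 ≤ U.card ∧
    ∃ (C : Walk V) (k : ℕ) (N : Finset (Sym2 V)), s.circ U = some C ∧ k < C.len ∧
      (∀ e ∈ s.M, Touches e U → Touches e (C.node k)) ∧
      IsNearPerfect C (C.node k) N ∧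
      t = { s with M := s.M ∪ N, Ω := s.Ω.erase U }

/-- One iteration of the algorithm.
* `augment`: an `M`-alternating walk of positive length between nodes of `X` that is a path is
  found, and `M` is augmented along it.
* `shrink`: a blossom is found; its node set is added to `Ω` (with dual value unchanged, i.e. `0`),
  and the edges of the blossom are removed from `M`.
* `dual`: `M` is not perfect and no such walk exists; the dual variables are changed by the largest
  feasible `α`, and then sets in `Ω_max` with at least three elements and dual value `0` are
  deshrunk, one after another, among them all those that were decreased to `0`. -/
inductive Step [Fintype V] [DecidableEq V] (G : SimpleGraph V) (w : Sym2 V → ℝ) :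
    State V → State V → Prop
  | augment (s : State V) (P : Walk V) (hP : s.IsXXWalk G w P) (hpath : P.IsPath) :
      Step G w s { s with M := symmDiff s.M P.edges }
  | shrink (s : State V) (P : Walk V) (i : ℕ) (hP : s.IsFlower G w P i) :
      Step G w s
        { M := s.M \ (blossom P i).edges
          Ω := insert (blossomSet P i) s.Ω
          π := s.π
          circ := Function.update s.circ (blossomSet P i) (some (blossom P i)) }
  | dual (s t : State V) (α : ℝ) (hX : s.exposed.Nonempty)
      (hno : ∀ P : Walk V, ¬ s.IsXXWalk G w P)
      (hα : IsGreatest (s.stepSizes G w) α)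
      (hdes : Relation.ReflTransGen (fun a b => ∃ U, a.π U = 0 ∧ Deshrink a U b)
        { s with π := s.shiftDual G w α } t)
      (hall : ∀ U ∈ s.oddReach G w, 3 ≤ U.card → s.shiftDual G w α U = 0 → U ∉ t.Ω) :
      Step G w s t

/-- `s` is a state that occurs in some run of the algorithm on `(G, w)`. -/
def Reachable [Fintype V] [DecidableEq V] (G : SimpleGraph V) (w : Sym2 V → ℝ)
    (s : State V) : Prop :=
  Relation.ReflTransGen (Step G w) (initial V) s

/-- In state `s` the algorithm asserts that `G` has no perfect matching: `M` is not perfect, there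
is no `M`-alternating walk of positive length between nodes of `X`, and the step size `α` of the
dual update can be chosen arbitrarily large. -/
def AssertsNoPerfectMatching [Fintype V] (G : SimpleGraph V) (w : Sym2 V → ℝ)
    (s : State V) : Prop :=
  s.exposed.Nonempty ∧ (∀ P : Walk V, ¬ s.IsXXWalk G w P) ∧ ¬ BddAbove (s.stepSizes G w)

/-- `N` is a set of edges of `G` obtained from the matching `M` of the state `s` by iteratively
deshrinking the sets in `Ω_max` until all of them are singletons. -/
def IsExpansion [DecidableEq V] (s : State V) (N : Finset (Sym2 V)) : Prop :=
  ∃ t : State V, Relation.ReflTransGen (fun a b => ∃ U, Deshrink a U b) s t ∧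
    (∀ U ∈ t.Ω, U.card = 1) ∧ t.M = N

end EdmondsMatching

/-!
The proof is a parity count in the manner of the Tutte–Berge formula.

Every state of a run satisfies `Invariant`: `Ω` is a laminar family of odd sets, `M` is a matching
of tight edges between its maximal members, and each shrunken set carries an odd circuit of tight
edges on its maximal proper subsets in `Ω`. For the dual step this rests on two facts. The circuit
edges lie inside a maximal set, and only maximal sets change their dual value
(`Invariant.cutSum_shiftDual_of_subset`). For a matching edge, one end is an odd node (in
`oddReach`) exactly if the other is an even node (in `evenReach`), so that the changes cancel
(`Invariant.dualSlope_add_eq_zero`); a node cannot be both, since otherwise two paths would combine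
to an alternating walk between exposed nodes (`not_mem_evenReach_of_mem_oddReach`).

An odd circuit minus a node has a perfect matching, so deshrinking is always possible. It preserves
the invariant and the number of exposed nodes (`Invariant.ncard_exposed_deshrink`). Once all sets
are singletons, `M` is therefore a matching of `G` that leaves exactly as many vertices uncovered as
there were exposed nodes.

It remains to see that no matching `N` of `G` leaves fewer vertices uncovered. When the step size is
unbounded, an odd node is a singleton, since its dual value would otherwise become negative, and an
edge of `G` that leaves an even node ends in an odd node, since otherwise its constraint would
become violated. As even nodes are odd sets of vertices, each of them contains a vertex that `N` does
not cover, or is joined by `N` to an odd vertex of its own. So the number of uncovered vertices is at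
least the number of even nodes minus the number of odd nodes (`Invariant.ncard_evenReach_le`). This
difference is at least the number of exposed nodes, because these are even nodes and the mates of
the odd nodes are further even nodes (`Invariant.ncard_exposed_add_le`).
-/

namespace EdmondsMatching

variable {V : Type*}

/-! ### Edges between node sets -/

theorem Joins.symm {e : Sym2 V} {A B : Finset V} (h : Joins e A B) : Joins e B A := by
  obtain ⟨a, ha, b, hb, rfl⟩ := h
  exact ⟨b, hb, a, ha, Sym2.eq_swap⟩

theorem Joins.touches_left {e : Sym2 V} {A B : Finset V} (h : Joins e A B) : Touches e A := by
  obtain ⟨a, ha, b, hb, rfl⟩ := h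
  exact ⟨a, by simp, ha⟩

theorem Joins.touches_right {e : Sym2 V} {A B : Finset V} (h : Joins e A B) : Touches e B :=
  h.symm.touches_left

theorem Joins.exists_mem_of_touches {e : Sym2 V} {A B D : Finset V} (h : Joins e A B)
    (hD : Touches e D) : (∃ v ∈ A, v ∈ D) ∨ ∃ v ∈ B, v ∈ D := by
  obtain ⟨a, ha, b, hb, rfl⟩ := h
  obtain ⟨v, hv, hvD⟩ := hD
  rcases Sym2.mem_iff.1 hv with rfl | rfl
  · exact Or.inl ⟨_, ha, hvD⟩
  · exact Or.inr ⟨_, hb, hvD⟩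

theorem Touches.mono {e : Sym2 V} {A B : Finset V} (h : Touches e A) (hAB : A ⊆ B) :
    Touches e B := by
  obtain ⟨v, hv, hA⟩ := h
  exact ⟨v, hv, hAB hA⟩

theorem Joins.mono {e : Sym2 V} {A A' B B' : Finset V} (h : Joins e A B) (hA : A ⊆ A')
    (hB : B ⊆ B') : Joins e A' B' := by
  obtain ⟨a, ha, b, hb, rfl⟩ := h
  exact ⟨a, hA ha, b, hB hb, rfl⟩

theorem InCut.touches {e : Sym2 V} {U : Finset V} (h : InCut e U) : Touches e U := by
  obtain ⟨u, v, rfl, hu, -⟩ := h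
  exact ⟨u, by simp, hu⟩

theorem not_inCut_of_joins_subset {e : Sym2 V} {A B U : Finset V} (h : Joins e A B)
    (hA : A ⊆ U) (hB : B ⊆ U) : ¬ InCut e U := by
  obtain ⟨a, ha, b, hb, rfl⟩ := h
  rintro ⟨u, v, he, hu, hv⟩
  have : v ∈ s(a, b) := by rw [he]; simp
  rcases Sym2.mem_iff.1 this with rfl | rfl
  · exact hv (hA ha)
  · exact hv (hB hb)

theorem Joins.inCut {e : Sym2 V} {A B : Finset V} (h : Joins e A B) (hd : Disjoint A B) :
    InCut e A := by
  obtain ⟨a, ha, b, hb, rfl⟩ := h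
  exact ⟨a, b, rfl, ha, fun hb' => (Finset.disjoint_left.1 hd) hb' hb⟩

/-! ### Maximal sets and walks -/

theorem exists_maxSets_of_mem {s : State V} {U : Finset V} (hU : U ∈ s.Ω) :
    ∃ A ∈ s.maxSets, U ⊆ A := by
  obtain ⟨A, h1, h2⟩ := Finset.exists_le_maximal s.Ω hU
  exact ⟨A, h2, h1⟩

theorem mem_of_maxSets {s : State V} {U : Finset V} (hU : U ∈ s.maxSets) : U ∈ s.Ω :=
  Maximal.prop hU

theorem eq_of_maxSets_subset {s : State V} {U W : Finset V} (hU : U ∈ s.maxSets) (hW : W ∈ s.Ω)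
    (h : U ⊆ W) : W = U :=
  (Maximal.eq_of_le hU hW h).symm

theorem isPath_prefix {P : Walk V} (hP : P.IsPath) {j : ℕ} (hj : j ≤ P.len) :
    Walk.IsPath { P with len := j } :=
  fun i hi k hk h => hP i (le_trans hi hj) k (le_trans hk hj) h

/-! ### The invariant of the algorithm -/

/-- `C` is an odd circuit of tight edges of `G` whose nodes are the inclusion-wise maximal proper
subsets of `U` in the family `Ω`; they partition `U`. -/
structure IsCircuitFor [Fintype V] (G : SimpleGraph V) (w : Sym2 V → ℝ) (Ω : Finset (Finset V))
    (π : Finset V → ℝ) (C : Walk V) (U : Finset V) : Prop where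
  odd_len : Odd C.len
  closed : C.node C.len = C.node 0
  disj : ∀ i < C.len, ∀ j < C.len, ∀ v, v ∈ C.node i → v ∈ C.node j → i = j
  mem : ∀ j < C.len, C.node j ∈ Ω
  mem_iff : ∀ v, v ∈ U ↔ ∃ j < C.len, v ∈ C.node j
  ne : ∀ j < C.len, C.node j ≠ C.node (j + 1)
  ne_self : ∀ j < C.len, C.node j ≠ U
  edge_mem : ∀ j < C.len, C.edge j ∈ G.edgeSet
  tight : ∀ j < C.len, cutSum π (C.edge j) = w (C.edge j)
  joins : ∀ j < C.len, Joins (C.edge j) (C.node j) (C.node (j + 1))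
  cover : ∀ W ∈ Ω, W ⊂ U → ∃ j < C.len, W ⊆ C.node j

/-- The properties that every state of a run has: `Ω` is a laminar family of odd sets that contains
the singletons, `M` is a matching in `G'`, and every shrunken set carries an odd circuit. -/
structure Invariant [Fintype V] (G : SimpleGraph V) (w : Sym2 V → ℝ) (s : State V) : Prop where
  singleton_mem : ∀ v, {v} ∈ s.Ω
  odd : ∀ U ∈ s.Ω, Odd U.card
  laminar : ∀ A ∈ s.Ω, ∀ B ∈ s.Ω, ∀ v, v ∈ A → v ∈ B → A ⊆ B ∨ B ⊆ A
  link : ∀ e ∈ s.M, ∃ A B, s.Link G w e A B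
  unique : ∀ e ∈ s.M, ∀ f ∈ s.M, ∀ A ∈ s.maxSets, Touches e A → Touches f A → e = f
  circ : ∀ U ∈ s.Ω, 3 ≤ U.card → ∃ C, s.circ U = some C ∧ IsCircuitFor G w s.Ω s.π C U

section Basic

variable [Fintype V] {G : SimpleGraph V} {w : Sym2 V → ℝ} {s : State V}

theorem State.Link.symm {e : Sym2 V} {A B : Finset V} (h : s.Link G w e A B) :
    s.Link G w e B A :=
  ⟨h.1, h.2.1, h.2.2.2.1, h.2.2.1, h.2.2.2.2.1.symm, h.2.2.2.2.2.symm⟩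

theorem State.Link.joins {e : Sym2 V} {A B : Finset V} (h : s.Link G w e A B) : Joins e A B :=
  h.2.2.2.2.2

namespace Invariant

theorem nonempty (I : Invariant G w s) {U : Finset V} (hU : U ∈ s.Ω) : U.Nonempty :=
  Finset.card_pos.1 (I.odd U hU).pos

theorem exists_maxSets (I : Invariant G w s) (v : V) : ∃ A ∈ s.maxSets, v ∈ A := by
  obtain ⟨A, hA, h⟩ := exists_maxSets_of_mem (I.singleton_mem v)
  exact ⟨A, hA, h (by simp)⟩

theorem maxSets_eq (I : Invariant G w s) {A B : Finset V} (hA : A ∈ s.maxSets)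
    (hB : B ∈ s.maxSets) {v : V} (hvA : v ∈ A) (hvB : v ∈ B) : A = B := by
  rcases I.laminar A (mem_of_maxSets hA) B (mem_of_maxSets hB) v hvA hvB with h | h
  · exact (eq_of_maxSets_subset hA (mem_of_maxSets hB) h).symm
  · exact eq_of_maxSets_subset hB (mem_of_maxSets hA) h

theorem maxSets_disjoint (I : Invariant G w s) {A B : Finset V} (hA : A ∈ s.maxSets)
    (hB : B ∈ s.maxSets) (hAB : A ≠ B) : Disjoint A B :=
  Finset.disjoint_left.2 fun _ h h' => hAB (I.maxSets_eq hA hB h h')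

theorem eq_or_eq_of_touches (I : Invariant G w s) {e : Sym2 V} {A B D : Finset V}
    (h : s.Link G w e A B) (hD : D ∈ s.maxSets) (ht : Touches e D) : D = A ∨ D = B := by
  rcases h.joins.exists_mem_of_touches ht with ⟨v, h1, h2⟩ | ⟨v, h1, h2⟩
  · exact Or.inl (I.maxSets_eq hD h.2.2.1 h2 h1)
  · exact Or.inr (I.maxSets_eq hD h.2.2.2.1 h2 h1)

theorem link_right_unique (I : Invariant G w s) {e : Sym2 V} {A B B' : Finset V}
    (h : s.Link G w e A B) (h' : s.Link G w e A B') : B' = B := by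
  rcases I.eq_or_eq_of_touches h h'.2.2.2.1 h'.joins.touches_right with h1 | h1
  · exact absurd h1.symm h'.2.2.2.2.1
  · exact h1

theorem link_of_touches (I : Invariant G w s) {e : Sym2 V} {A : Finset V} (he : e ∈ s.M)
    (hA : A ∈ s.maxSets) (ht : Touches e A) : ∃ B, s.Link G w e A B := by
  obtain ⟨B, D, h⟩ := I.link e he
  rcases I.eq_or_eq_of_touches h hA ht with rfl | rfl
  · exact ⟨_, h⟩
  · exact ⟨_, h.symm⟩

end Invariant

/-! ### Odd circuits -/

theorem IsCircuitFor.node_succ {Ω : Finset (Finset V)} {π : Finset V → ℝ} {C : Walk V}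
    {U : Finset V} (c : IsCircuitFor G w Ω π C U) {i : ℕ} (hi : i < C.len) :
    ∃ j < C.len, C.node (i + 1) = C.node j ∧ (j = i + 1 ∨ i + 1 = C.len ∧ j = 0) := by
  rcases Nat.lt_or_ge (i + 1) C.len with h | h
  · exact ⟨i + 1, h, rfl, Or.inl rfl⟩
  · have : i + 1 = C.len := by omega
    exact ⟨0, by omega, by rw [this, c.closed], Or.inr ⟨this, rfl⟩⟩

theorem IsCircuitFor.node_subset {Ω : Finset (Finset V)} {π : Finset V → ℝ} {C : Walk V}
    {U : Finset V} (c : IsCircuitFor G w Ω π C U) {i : ℕ} (hi : i < C.len) : C.node i ⊆ U :=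
  fun v hv => (c.mem_iff v).2 ⟨i, hi, hv⟩

theorem IsCircuitFor.touches_iff {Ω : Finset (Finset V)} {π : Finset V → ℝ} {C : Walk V}
    {U : Finset V} (c : IsCircuitFor G w Ω π C U) {i j : ℕ} (hi : i < C.len) (hj : j < C.len) :
    Touches (C.edge i) (C.node j) ↔ j = i ∨ j = i + 1 ∨ i + 1 = C.len ∧ j = 0 := by
  obtain ⟨k, hk, hkn, hki⟩ := c.node_succ hi
  have hJ := c.joins i hi
  constructor
  · intro ht
    rcases hJ.exists_mem_of_touches ht with ⟨v, h1, h2⟩ | ⟨v, h1, h2⟩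
    · exact Or.inl (c.disj i hi j hj v h1 h2).symm
    · rw [hkn] at h1
      have := c.disj k hk j hj v h1 h2
      omega
  · intro h
    have h2 := hJ.touches_right
    rw [hkn] at h2
    rcases h with rfl | h
    · exact hJ.touches_left
    · have : j = k := by omega
      rwa [this]

/-- An edge of the circuit of `U` touches no node outside `U`. -/
theorem Invariant.not_touches_of_circuit (I : Invariant G w s) {U : Finset V} {C : Walk V}
    (hU : U ∈ s.maxSets) (c : IsCircuitFor G w s.Ω s.π C U) {i : ℕ} (hi : i < C.len)
    {A : Finset V} (hA : A ∈ s.maxSets) (hAU : A ≠ U) : ¬ Touches (C.edge i) A := by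
  intro ht
  obtain ⟨k, hk, hkn, -⟩ := c.node_succ hi
  rcases (c.joins i hi).exists_mem_of_touches ht with ⟨v, h1, h2⟩ | ⟨v, h1, h2⟩
  · exact hAU (I.maxSets_eq hA hU h2 (c.node_subset hi h1))
  · rw [hkn] at h1
    exact hAU (I.maxSets_eq hA hU h2 (c.node_subset hk h1))

/-- A matching edge has at most one end in a maximal set, so inside `U` it touches only the node
of the circuit that is left out when `U` is deshrunk. -/
theorem Invariant.eq_of_touches_node (I : Invariant G w s) {U : Finset V} {C : Walk V}
    (hU : U ∈ s.maxSets) (c : IsCircuitFor G w s.Ω s.π C U) {k : ℕ} (hk : k < C.len)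
    (hcov : ∀ e ∈ s.M, Touches e U → Touches e (C.node k)) {e : Sym2 V} (he : e ∈ s.M) {j : ℕ}
    (hj : j < C.len) (ht : Touches e (C.node j)) : j = k := by
  have htU := ht.mono (c.node_subset hj)
  obtain ⟨B, h⟩ := I.link_of_touches he hU htU
  have htk := hcov e he htU
  have hd := I.maxSets_disjoint hU h.2.2.2.1 h.2.2.2.2.1
  obtain ⟨a, ha, b, hb, rfl⟩ := h.joins
  have hend : ∀ i < C.len, Touches s(a, b) (C.node i) → a ∈ C.node i := by
    rintro i hi ⟨v, hv, hvi⟩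
    rcases Sym2.mem_iff.1 hv with rfl | rfl
    · exact hvi
    · exact absurd hb (Finset.disjoint_left.1 hd (c.node_subset hi hvi))
  exact c.disj j hj k hk a (hend j hj ht) (hend k hk htk)

/-! ### Alternating walks from exposed nodes -/

theorem node_mem_maxSets {P : Walk V} (hP : s.IsAlternating G w P) (h0 : P.node 0 ∈ s.exposed)
    {j : ℕ} (hj : j ≤ P.len) : P.node j ∈ s.maxSets := by
  rcases Nat.eq_zero_or_pos j with rfl | hj0
  · exact h0.1
  · obtain ⟨k, rfl⟩ : ∃ k, j = k + 1 := ⟨j - 1, by omega⟩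
    exact (hP.1 k (by omega)).2.2.2.1

/-- An alternating walk that starts at an exposed node begins with an edge outside `M`, so its
matching edges are those with odd index. -/
theorem edge_mem_iff_odd {P : Walk V} (hP : s.IsAlternating G w P) (h0 : P.node 0 ∈ s.exposed) :
    ∀ i < P.len, (P.edge i ∈ s.M ↔ Odd i) := by
  intro i
  induction i with
  | zero =>
    intro hi
    have h := (hP.1 0 hi).joins.touches_left
    simp only [Nat.not_odd_zero, iff_false]
    exact fun hM => h0.2 _ hM h
  | succ n ih =>
    intro hi
    have h1 := ih (by omega)
    have h2 := hP.2 n hi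
    rw [Nat.odd_add_one]
    tauto

/-- A matching edge at a non-final node of an alternating walk from an exposed node lies on the
walk, next to that node. -/
theorem Invariant.eq_edge_of_touches (I : Invariant G w s) {P : Walk V}
    (hP : s.IsAlternating G w P) (h0 : P.node 0 ∈ s.exposed) {e : Sym2 V} (he : e ∈ s.M) {j : ℕ}
    (hj : j < P.len) (ht : Touches e (P.node j)) :
    (Odd j ∧ e = P.edge j) ∨ ∃ k, j = k + 1 ∧ Odd k ∧ e = P.edge k := by
  have hM := edge_mem_iff_odd hP h0
  have hm := node_mem_maxSets hP h0 hj.le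
  rcases Nat.even_or_odd j with hev | hod
  · rcases Nat.eq_zero_or_pos j with rfl | hpos
    · exact absurd ht (h0.2 e he)
    · obtain ⟨k, rfl⟩ : ∃ k, j = k + 1 := ⟨j - 1, by omega⟩
      have hk : Odd k := by rwa [← Nat.not_even_iff_odd, ← Nat.even_add_one]
      exact Or.inr ⟨k, rfl, hk, I.unique e he _ ((hM k (by omega)).2 hk) _ hm ht
        (hP.1 k (by omega)).joins.touches_right⟩
  · exact Or.inl ⟨hod, I.unique e he _ ((hM j hj).2 hod) _ hm ht (hP.1 j hj).joins.touches_left⟩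

theorem isAlternating_prefix {P : Walk V} (hP : s.IsAlternating G w P) {j : ℕ} (hj : j ≤ P.len) :
    s.IsAlternating G w { P with len := j } :=
  ⟨fun i hi => hP.1 i (lt_of_lt_of_le hi hj), fun i hi => hP.2 i (lt_of_lt_of_le hi hj)⟩

theorem mem_evenReach_of_prefix {P : Walk V} (hP : s.IsAlternating G w P) (hp : P.IsPath)
    (h0 : P.node 0 ∈ s.exposed) {j : ℕ} (hj : j ≤ P.len) (he : Even j) :
    P.node j ∈ s.evenReach G w :=
  ⟨node_mem_maxSets hP h0 hj, _, isAlternating_prefix hP hj, isPath_prefix hp hj, h0, rfl, he⟩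

theorem mem_oddReach_of_prefix {P : Walk V} (hP : s.IsAlternating G w P) (hp : P.IsPath)
    (h0 : P.node 0 ∈ s.exposed) {j : ℕ} (hj : j ≤ P.len) (ho : Odd j) :
    P.node j ∈ s.oddReach G w :=
  ⟨node_mem_maxSets hP h0 hj, _, isAlternating_prefix hP hj, isPath_prefix hp hj, h0, rfl, ho⟩

theorem Invariant.exposed_subset_evenReach (I : Invariant G w s) :
    s.exposed ⊆ s.evenReach G w := by
  intro U hU
  obtain ⟨v, -⟩ := I.nonempty (mem_of_maxSets hU.1)
  exact ⟨hU.1, ⟨0, fun _ => U, fun _ => s(v, v)⟩, ⟨by simp, by simp⟩,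
    fun i hi j hj _ => by simp only [Nat.le_zero] at hi hj; rw [hi, hj], hU, rfl, Even.zero⟩

/-- An odd and an even alternating path to the same node combine to an alternating walk between
exposed nodes. -/
theorem not_mem_evenReach_of_mem_oddReach (hno : ∀ P : Walk V, ¬ s.IsXXWalk G w P)
    {U : Finset V} (hS : U ∈ s.oddReach G w) : U ∉ s.evenReach G w := by
  rintro ⟨-, Q, hQ, -, hQ0, hQU, hQe⟩
  obtain ⟨-, P, hP, -, hP0, hPU, hPo⟩ := hS
  let R : Walk V :=
    { len := P.len + Q.len
      node := fun n => if n ≤ P.len then P.node n else Q.node (P.len + Q.len - n)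
      edge := fun n => if n < P.len then P.edge n else Q.edge (P.len + Q.len - 1 - n) }
  have hM : ∀ n < R.len, (R.edge n ∈ s.M ↔ Odd n) := by
    intro n hn
    change n < P.len + Q.len at hn
    by_cases h : n < P.len
    · simp only [R, h, if_true]
      exact edge_mem_iff_odd hP hP0 n h
    · simp only [R, h, if_false]
      rw [edge_mem_iff_odd hQ hQ0 _ (by omega)]
      rw [Nat.odd_iff] at *
      rw [Nat.even_iff] at *
      rw [Nat.odd_iff]
      omega
  refine hno R ⟨⟨?_, ?_⟩, ?_, ?_, ?_⟩
  · intro n hn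
    change n < P.len + Q.len at hn
    by_cases h : n < P.len
    · simp only [R, h, if_true, h.le, Nat.succ_le_of_lt h]
      exact hP.1 n h
    · have e1 : (if n ≤ P.len then P.node n else Q.node (P.len + Q.len - n))
          = Q.node (P.len + Q.len - 1 - n + 1) := by
        split_ifs with h'
        · have : n = P.len := by omega
          subst this
          rw [hPU, ← hQU]; congr 1; omega
        · congr 1; omega
      have e2 : ¬ n + 1 ≤ P.len := by omega
      simp only [R, h, if_false, e1, e2]
      have := (hQ.1 (P.len + Q.len - 1 - n) (by omega)).symm
      have e3 : P.len + Q.len - (n + 1) = P.len + Q.len - 1 - n := by omega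
      rwa [e3]
  · intro n hn
    rw [hM n (by omega), hM (n + 1) hn, Nat.odd_add_one]
    tauto
  · have := hPo.pos
    change 0 < P.len + Q.len
    omega
  · simpa [R] using hP0
  · by_cases h : Q.len = 0
    · rw [h] at hQU
      simp only [R, h, add_zero, le_refl, if_true, hPU, ← hQU]
      exact hQ0
    · simpa [R, h] using hQ0

/-- The mate of an oddly reached node is evenly reached. -/
theorem Invariant.mem_evenReach_of_link (I : Invariant G w s) {e : Sym2 V} {A B : Finset V}
    (he : e ∈ s.M) (h : s.Link G w e A B) (hA : A ∈ s.oddReach G w) : B ∈ s.evenReach G w := by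
  obtain ⟨hAm, P, hP, hp, h0, rfl, ho⟩ := hA
  have hM := edge_mem_iff_odd hP h0
  by_cases hB : ∃ j ≤ P.len, P.node j = B
  · obtain ⟨j, hj, rfl⟩ := hB
    rcases Nat.even_or_odd j with hev | hod
    · exact mem_evenReach_of_prefix hP hp h0 hj hev
    · exfalso
      have hj' : j < P.len := lt_of_le_of_ne hj (by rintro rfl; exact h.2.2.2.2.1 rfl)
      have hjM := (hM j hj').2 hod
      have hl := hP.1 j hj'
      have : e = P.edge j := I.unique _ he _ hjM _ hl.2.2.1 h.joins.touches_right
        hl.joins.touches_left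
      subst this
      have := hp _ le_rfl _ hj' (I.link_right_unique hl h.symm)
      rw [this, Nat.odd_add_one] at ho
      exact ho hod
  · push Not at hB
    refine ⟨h.2.2.2.1, ⟨P.len + 1, fun n => if n ≤ P.len then P.node n else B,
      fun n => if n < P.len then P.edge n else e⟩, ⟨?_, ?_⟩, ?_, ?_, ?_, ?_⟩
    · intro n hn
      by_cases h' : n < P.len
      · simp only [h', if_true, h'.le, Nat.succ_le_of_lt h']
        exact hP.1 n h'
      · have : n = P.len := by simp only at hn; omega
        subst this
        simpa using h
    · intro n hn
      simp only at hn
      by_cases h' : n + 1 < P.len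
      · simp only [h', if_true, show n < P.len by omega]
        exact hP.2 n h'
      · have : n + 1 = P.len := by omega
        simp only [h', if_false, show n < P.len by omega, if_true, he, not_true, iff_false]
        rw [hM n (by omega)]
        rw [← this, Nat.odd_add_one] at ho
        exact ho
    · intro n hn m hm hnm
      simp only at hn hm hnm
      split_ifs at hnm with h1 h2 h2
      · exact hp n h1 m h2 hnm
      · exact absurd hnm (hB n h1)
      · exact absurd hnm.symm (hB m h2)
      · omega
    · simpa using h0
    · simp
    · exact ho.add_one

/-- The mate of an evenly reached node is oddly reached. -/
theorem Invariant.mem_oddReach_of_link (I : Invariant G w s) {e : Sym2 V} {A B : Finset V}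
    (he : e ∈ s.M) (h : s.Link G w e A B) (hA : A ∈ s.evenReach G w) : B ∈ s.oddReach G w := by
  obtain ⟨hAm, P, hP, hp, h0, rfl, hev⟩ := hA
  have hM := edge_mem_iff_odd hP h0
  rcases Nat.eq_zero_or_pos P.len with hz | hpos
  · rw [hz] at h
    exact absurd h.joins.touches_left (h0.2 _ he)
  · obtain ⟨k, hk⟩ : ∃ k, P.len = k + 1 := ⟨P.len - 1, by omega⟩
    rw [hk] at h hev
    have hkodd : Odd k := by
      rwa [← Nat.not_even_iff_odd, ← Nat.even_add_one]
    have hl := hP.1 k (by omega)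
    have : e = P.edge k := I.unique _ he _ ((hM k (by omega)).2 hkodd) _ hl.2.2.2.1
      h.joins.touches_left hl.joins.touches_right
    subst this
    rw [I.link_right_unique hl.symm h]
    exact mem_oddReach_of_prefix hP hp h0 (by omega) hkodd

/-! ### The dual change -/

open Classical in
/-- The rate at which the dual change alters `π U`. -/
noncomputable def dualSlope (G : SimpleGraph V) (w : Sym2 V → ℝ) (s : State V)
    (U : Finset V) : ℝ :=
  (if U ∈ s.evenReach G w then 1 else 0) - (if U ∈ s.oddReach G w then 1 else 0)

theorem shiftDual_eq (α : ℝ) (U : Finset V) :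
    s.shiftDual G w α U = s.π U + α * dualSlope G w s U := by
  unfold State.shiftDual dualSlope
  split_ifs <;> ring

theorem mem_maxSets_of_dualSlope_ne_zero {U : Finset V} (h : dualSlope G w s U ≠ 0) :
    U ∈ s.maxSets := by
  unfold dualSlope at h
  by_contra hU
  rw [if_neg (fun h' => hU h'.1), if_neg (fun h' => hU h'.1)] at h
  simp at h

open Classical in
theorem cutSum_shiftDual (α : ℝ) (e : Sym2 V) :
    cutSum (s.shiftDual G w α) e = cutSum s.π e + α *
      ∑ U ∈ Finset.univ.filter (fun U : Finset V => Odd U.card ∧ InCut e U),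
        dualSlope G w s U := by
  unfold cutSum
  rw [Finset.mul_sum, ← Finset.sum_add_distrib]
  exact Finset.sum_congr rfl fun U _ => shiftDual_eq α U

/-- Only maximal sets change their dual value, so the constraint of an edge inside one of them is
not affected. -/
theorem Invariant.cutSum_shiftDual_of_subset (I : Invariant G w s) (α : ℝ) {e : Sym2 V}
    {A B U : Finset V} (h : Joins e A B) (hU : U ∈ s.maxSets) (hA : A ⊆ U) (hB : B ⊆ U) :
    cutSum (s.shiftDual G w α) e = cutSum s.π e := by
  classical
  rw [cutSum_shiftDual, Finset.sum_eq_zero, mul_zero, add_zero]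
  intro W hW
  by_contra hne
  have hWm := mem_maxSets_of_dualSlope_ne_zero hne
  have hcut := (Finset.mem_filter.1 hW).2.2
  have : W = U := by
    rcases h.exists_mem_of_touches hcut.touches with ⟨v, h1, h2⟩ | ⟨v, h1, h2⟩
    · exact I.maxSets_eq hWm hU h2 (hA h1)
    · exact I.maxSets_eq hWm hU h2 (hB h1)
  subst this
  exact not_inCut_of_joins_subset h hA hB hcut

theorem Invariant.cutSum_shiftDual_of_joins (I : Invariant G w s) (α : ℝ) {e : Sym2 V}
    {A B : Finset V} (h : Joins e A B) (hA : A ∈ s.maxSets) (hB : B ∈ s.maxSets) (hAB : A ≠ B) :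
    cutSum (s.shiftDual G w α) e =
      cutSum s.π e + α * (dualSlope G w s A + dualSlope G w s B) := by
  classical
  rw [cutSum_shiftDual, ← Finset.sum_pair hAB]
  congr 2
  symm
  have hd := I.maxSets_disjoint hA hB hAB
  refine Finset.sum_subset ?_ ?_
  · intro W hW
    simp only [Finset.mem_insert, Finset.mem_singleton] at hW
    simp only [Finset.mem_filter, Finset.mem_univ, true_and]
    rcases hW with rfl | rfl
    · exact ⟨I.odd _ (mem_of_maxSets hA), h.inCut hd⟩
    · exact ⟨I.odd _ (mem_of_maxSets hB), h.symm.inCut hd.symm⟩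
  · intro W hW hW'
    by_contra hne
    have hWm := mem_maxSets_of_dualSlope_ne_zero hne
    apply hW'
    simp only [Finset.mem_insert, Finset.mem_singleton]
    rcases h.exists_mem_of_touches (Finset.mem_filter.1 hW).2.2.touches with
      ⟨v, h1, h2⟩ | ⟨v, h1, h2⟩
    · exact Or.inl (I.maxSets_eq hWm hA h2 h1)
    · exact Or.inr (I.maxSets_eq hWm hB h2 h1)

theorem dualSlope_of_mem_oddReach (hno : ∀ P : Walk V, ¬ s.IsXXWalk G w P) {U : Finset V}
    (h : U ∈ s.oddReach G w) : dualSlope G w s U = -1 := by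
  have := not_mem_evenReach_of_mem_oddReach hno h
  simp [dualSlope, h, this]

theorem dualSlope_of_mem_evenReach (hno : ∀ P : Walk V, ¬ s.IsXXWalk G w P) {U : Finset V}
    (h : U ∈ s.evenReach G w) : dualSlope G w s U = 1 := by
  have : U ∉ s.oddReach G w := fun h' => not_mem_evenReach_of_mem_oddReach hno h' h
  simp [dualSlope, h, this]

theorem dualSlope_nonneg {U : Finset V} (h : U ∉ s.oddReach G w) : 0 ≤ dualSlope G w s U := by
  unfold dualSlope
  rw [if_neg h]
  split_ifs <;> simp

/-- Matching edges stay tight: one end is decreased exactly if the other one is increased. -/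
theorem Invariant.dualSlope_add_eq_zero (I : Invariant G w s)
    (hno : ∀ P : Walk V, ¬ s.IsXXWalk G w P) {e : Sym2 V} {A B : Finset V} (he : e ∈ s.M)
    (h : s.Link G w e A B) : dualSlope G w s A + dualSlope G w s B = 0 := by
  by_cases hS : A ∈ s.oddReach G w
  · rw [dualSlope_of_mem_oddReach hno hS,
      dualSlope_of_mem_evenReach hno (I.mem_evenReach_of_link he h hS)]
    norm_num
  · by_cases hT : A ∈ s.evenReach G w
    · rw [dualSlope_of_mem_evenReach hno hT,
        dualSlope_of_mem_oddReach hno (I.mem_oddReach_of_link he h hT)]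
      norm_num
    · have hS' : B ∉ s.oddReach G w := fun h' => hT (I.mem_evenReach_of_link he h.symm h')
      have hT' : B ∉ s.evenReach G w := fun h' => hS (I.mem_oddReach_of_link he h.symm h')
      simp [dualSlope, hS, hT, hS', hT']

theorem Invariant.shiftDual (I : Invariant G w s) (hno : ∀ P : Walk V, ¬ s.IsXXWalk G w P)
    (α : ℝ) : Invariant G w { s with π := s.shiftDual G w α } where
  singleton_mem := I.singleton_mem
  odd := I.odd
  laminar := I.laminar
  link e he := by
    obtain ⟨A, B, h⟩ := I.link e he
    refine ⟨A, B, h.1, ?_, h.2.2⟩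
    change cutSum (s.shiftDual G w α) e = w e
    rw [I.cutSum_shiftDual_of_joins α h.joins h.2.2.1 h.2.2.2.1 h.2.2.2.2.1,
      I.dualSlope_add_eq_zero hno he h, mul_zero, add_zero]
    exact h.2.1
  unique := I.unique
  circ U hU h3 := by
    obtain ⟨C, hC, c⟩ := I.circ U hU h3
    refine ⟨C, hC, { c with tight := ?_ }⟩
    intro j hj
    obtain ⟨A, hA, hUA⟩ := exists_maxSets_of_mem hU
    have hsub : ∀ i < C.len, C.node i ⊆ A := fun i hi v hv =>
      hUA ((c.mem_iff v).2 ⟨i, hi, hv⟩)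
    have hsub' : C.node (j + 1) ⊆ A := by
      rcases Nat.lt_or_ge (j + 1) C.len with h | h
      · exact hsub _ h
      · rw [show j + 1 = C.len by omega, c.closed]
        exact hsub 0 (by omega)
    exact (I.cutSum_shiftDual_of_subset α (c.joins j hj) hA (hsub j hj) hsub').trans (c.tight j hj)

end Basic

/-! ### Edges and nodes of a blossom -/

theorem mem_edges [DecidableEq V] {P : Walk V} {e : Sym2 V} :
    e ∈ P.edges ↔ ∃ i < P.len, P.edge i = e := by
  simp [Walk.edges]

theorem IsNearPerfect.exists_edge [DecidableEq V] {C : Walk V} {B : Finset V}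
    {N : Finset (Sym2 V)} (hN : IsNearPerfect C B N) {e : Sym2 V} (he : e ∈ N) :
    ∃ i < C.len, e = C.edge i := by
  obtain ⟨i, hi, h⟩ := mem_edges.1 (hN.1 he)
  exact ⟨i, hi, h.symm⟩

theorem mem_blossomSet [DecidableEq V] {P : Walk V} {i : ℕ} {v : V} :
    v ∈ blossomSet P i ↔ ∃ j, i ≤ j ∧ j < P.len ∧ v ∈ P.node j := by
  simp [blossomSet, and_assoc]

theorem node_subset_blossomSet [DecidableEq V] {P : Walk V} {i j : ℕ} (hij : i ≤ j)
    (hj : j < P.len) : P.node j ⊆ blossomSet P i :=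
  fun _ hv => mem_blossomSet.2 ⟨j, hij, hj, hv⟩

/-- After shrinking, the maximal sets are the new set and the old ones outside the blossom. -/
theorem maxSets_shrink [DecidableEq V] {s : State V} {P : Walk V} {i : ℕ} {t : State V}
    (ht : t.Ω = insert (blossomSet P i) s.Ω)
    {A : Finset V} (hA : A ∈ t.maxSets) :
    A = blossomSet P i ∨ A ∈ s.maxSets ∧ ∀ j, i ≤ j → j < P.len → A ≠ P.node j := by
  have hAt := hA.prop
  have hmax : ∀ W ∈ t.Ω, A ⊆ W → W = A := fun W hW h => eq_of_maxSets_subset hA hW h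
  simp only [ht, Finset.mem_insert] at hAt hmax
  rcases hAt with h | h
  · exact Or.inl h
  · refine or_iff_not_imp_left.2 fun hne => ⟨⟨h, fun W hW hAW => (hmax W (Or.inr hW) hAW).le⟩, ?_⟩
    rintro j hij hj rfl
    exact hne (hmax _ (Or.inl rfl) (node_subset_blossomSet hij hj)).symm

section Steps

variable [Fintype V] [DecidableEq V] {G : SimpleGraph V} {w : Sym2 V → ℝ} {s : State V}

/-! ### The initial state and augmenting -/

theorem invariant_initial : Invariant G w (initial V) where
  singleton_mem v := Finset.mem_image_of_mem _ (Finset.mem_univ v)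
  odd U hU := by
    obtain ⟨v, -, rfl⟩ := Finset.mem_image.1 hU
    simp
  laminar A hA B hB v hvA hvB := by
    obtain ⟨a, -, rfl⟩ := Finset.mem_image.1 hA
    obtain ⟨b, -, rfl⟩ := Finset.mem_image.1 hB
    rw [Finset.mem_singleton] at hvA hvB
    subst hvA; subst hvB
    exact Or.inl subset_rfl
  link e he := absurd he (Finset.notMem_empty e)
  unique e he := absurd he (Finset.notMem_empty e)
  circ U hU h3 := by
    obtain ⟨v, -, rfl⟩ := Finset.mem_image.1 hU
    simp at h3

theorem Invariant.augment (I : Invariant G w s) {P : Walk V} (hP : s.IsXXWalk G w P)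
    (hp : P.IsPath) : Invariant G w { s with M := symmDiff s.M P.edges } := by
  obtain ⟨hA, -, h0, hlast⟩ := hP
  have hM := edge_mem_iff_odd hA h0
  -- An edge of the path that touches its `j`-th node is one of the two edges next to it.
  have hadj : ∀ i < P.len, ∀ j ≤ P.len, Touches (P.edge i) (P.node j) → j = i ∨ j = i + 1 := by
    intro i hi j hj ht
    rcases I.eq_or_eq_of_touches (hA.1 i hi) (node_mem_maxSets hA h0 hj) ht with h | h
    · exact Or.inl (hp _ hj _ hi.le h)
    · exact Or.inr (hp _ hj _ (by omega) h)
  -- Every matching edge that touches a node of the path lies on the path.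
  have hon : ∀ e ∈ s.M, ∀ j ≤ P.len, Touches e (P.node j) → e ∈ P.edges := by
    intro e he j hj ht
    rcases hj.lt_or_eq with hj | rfl
    · rcases I.eq_edge_of_touches hA h0 he hj ht with ⟨-, rfl⟩ | ⟨k, rfl, -, rfl⟩
      · exact mem_edges.2 ⟨_, hj, rfl⟩
      · exact mem_edges.2 ⟨k, by omega, rfl⟩
    · exact absurd ht (hlast.2 e he)
  -- Two edges outside `M` on the path that touch the same node have even indices, so they agree.
  have hPP : ∀ i < P.len, ∀ i' < P.len, P.edge i ∉ s.M → P.edge i' ∉ s.M → ∀ A ∈ s.maxSets,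
      Touches (P.edge i) A → Touches (P.edge i') A → P.edge i = P.edge i' := by
    intro i hi i' hi' hiM hiM' A hAm h1 h2
    rw [hM _ hi, Nat.not_odd_iff_even] at hiM
    rw [hM _ hi', Nat.not_odd_iff_even] at hiM'
    obtain ⟨j, hj, rfl⟩ : ∃ j ≤ P.len, A = P.node j := by
      rcases I.eq_or_eq_of_touches (hA.1 i hi) hAm h1 with h | h
      · exact ⟨i, hi.le, h⟩
      · exact ⟨i + 1, hi, h⟩
    have a1 := hadj i hi j hj h1
    have a2 := hadj i' hi' j hj h2
    rw [Nat.even_iff] at hiM hiM'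
    have : i = i' := by omega
    rw [this]
  have hPM : ∀ i < P.len, P.edge i ∉ s.M → ∀ f ∈ s.M, f ∉ P.edges → ∀ A ∈ s.maxSets,
      Touches (P.edge i) A → ¬ Touches f A := by
    intro i hi hiM f hf hfP A hAm h1 h2
    rcases I.eq_or_eq_of_touches (hA.1 i hi) hAm h1 with rfl | rfl
    · exact hfP (hon f hf _ hi.le h2)
    · exact hfP (hon f hf _ hi h2)
  refine ⟨I.singleton_mem, I.odd, I.laminar, ?_, ?_, I.circ⟩
  · intro e he
    rcases Finset.mem_symmDiff.1 he with ⟨he, -⟩ | ⟨he, -⟩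
    · exact I.link e he
    · obtain ⟨i, hi, rfl⟩ := mem_edges.1 he
      exact ⟨_, _, hA.1 i hi⟩
  · intro e he f hf A hAm hte htf
    rcases Finset.mem_symmDiff.1 he with ⟨he, he'⟩ | ⟨he, he'⟩ <;>
      rcases Finset.mem_symmDiff.1 hf with ⟨hf, hf'⟩ | ⟨hf, hf'⟩
    · exact I.unique e he f hf A hAm hte htf
    · obtain ⟨i, hi, rfl⟩ := mem_edges.1 hf
      exact absurd hte (hPM i hi hf' e he he' A hAm htf)
    · obtain ⟨i, hi, rfl⟩ := mem_edges.1 he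
      exact absurd htf (hPM i hi he' f hf hf' A hAm hte)
    · obtain ⟨i, hi, rfl⟩ := mem_edges.1 he
      obtain ⟨i', hi', rfl⟩ := mem_edges.1 hf
      exact hPP i hi i' hi' he' hf' A hAm hte htf

/-! ### Shrinking -/

theorem Invariant.odd_card_blossomSet (I : Invariant G w s) {P : Walk V} {i : ℕ}
    (hP : s.IsFlower G w P i) : Odd (blossomSet P i).card := by
  obtain ⟨hA, h0, hodd, hev, hi, hend, hinj⟩ := hP
  rw [blossomSet, Finset.card_biUnion, Finset.odd_sum_iff_odd_card_odd, Finset.filter_true_of_mem]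
  · rw [Nat.card_Ico]
    exact Nat.Odd.sub_even hi.le hodd hev
  · intro j hj
    exact I.odd _ (mem_of_maxSets (node_mem_maxSets hA h0 (Finset.mem_Ico.1 hj).2.le))
  · intro j hj k hk hjk
    rw [Finset.mem_coe, Finset.mem_Ico] at hj hk
    exact I.maxSets_disjoint (node_mem_maxSets hA h0 hj.2.le) (node_mem_maxSets hA h0 hk.2.le)
      fun h => hjk (hinj j hj.2 k hk.2 h)

theorem Invariant.maxSets_of_shrink (I : Invariant G w s) {P : Walk V} {i : ℕ}
    (hP : s.IsFlower G w P i) {t : State V} (ht : t.Ω = insert (blossomSet P i) s.Ω)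
    {A : Finset V} (hA : A ∈ s.maxSets) (hne : ∀ j, i ≤ j → j < P.len → A ≠ P.node j) :
    A ∈ t.maxSets := by
  refine ⟨by simp only [ht, Finset.mem_insert]; exact Or.inr hA.prop, fun W hW hAW => ?_⟩
  simp only [ht, Finset.mem_insert] at hW
  rcases hW with rfl | hW
  · obtain ⟨v, hv⟩ := I.nonempty hA.prop
    obtain ⟨j, hij, hj, hvj⟩ := mem_blossomSet.1 (hAW hv)
    exact absurd (I.maxSets_eq hA (node_mem_maxSets hP.1 hP.2.1 hj.le) hv hvj) (hne j hij hj)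
  · exact (eq_of_maxSets_subset hA hW hAW).le

theorem blossomSet_mem_maxSets {P : Walk V} {i : ℕ}
    (hP : s.IsFlower G w P i) {t : State V} (ht : t.Ω = insert (blossomSet P i) s.Ω) :
    blossomSet P i ∈ t.maxSets := by
  refine ⟨by simp [ht], fun W hW hAW => ?_⟩
  simp only [ht, Finset.mem_insert] at hW
  rcases hW with rfl | hW
  · exact le_rfl
  · have := eq_of_maxSets_subset (node_mem_maxSets hP.1 hP.2.1 hP.2.2.2.2.1.le) hW
      ((node_subset_blossomSet le_rfl hP.2.2.2.2.1).trans hAW)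
    rw [this]
    exact node_subset_blossomSet le_rfl hP.2.2.2.2.1

theorem Invariant.isCircuitFor_blossom (I : Invariant G w s) {P : Walk V} {i : ℕ}
    (hP : s.IsFlower G w P i) :
    IsCircuitFor G w (insert (blossomSet P i) s.Ω) s.π (blossom P i) (blossomSet P i) := by
  obtain ⟨hA, h0, hodd, hev, hi, hend, hinj⟩ := hP
  have hm : ∀ j ≤ P.len, P.node j ∈ s.maxSets := fun j hj => node_mem_maxSets hA h0 hj
  have hlt : ∀ j < (blossom P i).len, i + j < P.len := fun j hj => by
    change j < P.len - i at hj
    omega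
  have hsub' : ∀ j, i ≤ j → j ≤ P.len → P.node j ⊆ blossomSet P i := by
    intro j hij hj
    rcases hj.lt_or_eq with h | rfl
    · exact node_subset_blossomSet hij h
    · rw [hend]
      exact node_subset_blossomSet le_rfl hi
  have hne_self : ∀ j, i ≤ j → j < P.len → P.node j ≠ blossomSet P i := by
    intro j hij hj h
    have hl := hA.1 j hj
    obtain ⟨v, hv⟩ := I.nonempty (hm (j + 1) hj).prop
    refine hl.2.2.2.2.1 (I.maxSets_eq (hm j hj.le) (hm (j + 1) hj) ?_ hv)
    rw [h]
    exact hsub' (j + 1) (by omega) hj hv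
  refine ⟨Nat.Odd.sub_even hi.le hodd hev, ?_, ?_, ?_, ?_, ?_, ?_, ?_, ?_, ?_, ?_⟩
  · change P.node (i + (P.len - i)) = P.node (i + 0)
    rw [Nat.add_sub_cancel' hi.le, hend, add_zero]
  · intro j hj k hk v h1 h2
    have := hinj _ (hlt j hj) _ (hlt k hk)
      (I.maxSets_eq (hm _ (hlt j hj).le) (hm _ (hlt k hk).le) h1 h2)
    omega
  · intro j hj
    exact Finset.mem_insert_of_mem (hm _ (hlt j hj).le).prop
  · intro v
    rw [mem_blossomSet]
    constructor
    · rintro ⟨j, hij, hj, hv⟩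
      refine ⟨j - i, ?_, ?_⟩
      · change j - i < P.len - i
        omega
      · change v ∈ P.node (i + (j - i))
        rwa [Nat.add_sub_cancel' hij]
    · rintro ⟨j, hj, hv⟩
      exact ⟨i + j, by omega, hlt j hj, hv⟩
  · intro j hj
    exact (hA.1 _ (hlt j hj)).2.2.2.2.1
  · intro j hj
    exact hne_self (i + j) (by omega) (hlt j hj)
  · intro j hj
    exact (hA.1 _ (hlt j hj)).1
  · intro j hj
    exact (hA.1 _ (hlt j hj)).2.1
  · intro j hj
    exact (hA.1 _ (hlt j hj)).joins
  · intro W hW hWU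
    have hWΩ : W ∈ s.Ω := (Finset.mem_insert.1 hW).resolve_left hWU.ne
    obtain ⟨A, hAm, hWA⟩ := exists_maxSets_of_mem hWΩ
    obtain ⟨v, hv⟩ := I.nonempty hWΩ
    obtain ⟨j, hij, hj, hvj⟩ := mem_blossomSet.1 (hWU.subset hv)
    obtain rfl := I.maxSets_eq hAm (hm j hj.le) (hWA hv) hvj
    refine ⟨j - i, ?_, ?_⟩
    · change j - i < P.len - i
      omega
    · change W ⊆ P.node (i + (j - i))
      rwa [Nat.add_sub_cancel' hij]

theorem Invariant.shrink (I : Invariant G w s) {P : Walk V} {i : ℕ} (hP : s.IsFlower G w P i) :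
    Invariant G w
      { M := s.M \ (blossom P i).edges
        Ω := insert (blossomSet P i) s.Ω
        π := s.π
        circ := Function.update s.circ (blossomSet P i) (some (blossom P i)) } := by
  have hcirc := I.isCircuitFor_blossom hP
  have hoddU := I.odd_card_blossomSet hP
  obtain ⟨hA, h0, -, -, hi, -, -⟩ := id hP
  have hm : ∀ j ≤ P.len, P.node j ∈ s.maxSets := fun j hj => node_mem_maxSets hA h0 hj
  -- The base `P.node i` is the only node of the blossom that a remaining matching edge touches.
  have hbase : ∀ e ∈ s.M \ (blossom P i).edges, ∀ j, i ≤ j → j < P.len →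
      Touches e (P.node j) → j = i := by
    intro e he j hij hj ht
    obtain ⟨heM, heB⟩ := Finset.mem_sdiff.1 he
    by_contra hne
    have hin : ∀ k, i ≤ k → k < P.len → e = P.edge k → False := by
      rintro k hik hk rfl
      refine heB (mem_edges.2 ⟨k - i, ?_, ?_⟩)
      · change k - i < P.len - i
        omega
      · change P.edge (i + (k - i)) = P.edge k
        rw [Nat.add_sub_cancel' hik]
    rcases I.eq_edge_of_touches hA h0 heM hj ht with ⟨-, h⟩ | ⟨k, rfl, -, h⟩
    · exact hin j hij hj h
    · exact hin k (by omega) (by omega) h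
  have hU : ∀ e ∈ s.M \ (blossom P i).edges, Touches e (blossomSet P i) →
      Touches e (P.node i) := by
    rintro e he ⟨v, hve, hv⟩
    obtain ⟨j, hij, hj, hvj⟩ := mem_blossomSet.1 hv
    have ht : Touches e (P.node j) := ⟨v, hve, hvj⟩
    rwa [hbase e he j hij hj ht] at ht
  refine ⟨fun v => Finset.mem_insert_of_mem (I.singleton_mem v), ?_, ?_, ?_, ?_, ?_⟩
  · intro U hU
    rcases Finset.mem_insert.1 hU with rfl | hU
    · exact hoddU
    · exact I.odd U hU
  · have key : ∀ B ∈ s.Ω, ∀ v, v ∈ blossomSet P i → v ∈ B → B ⊆ blossomSet P i := by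
      intro B hB v hv hvB
      obtain ⟨j, hij, hj, hvj⟩ := mem_blossomSet.1 hv
      obtain ⟨A, hAm, hBA⟩ := exists_maxSets_of_mem hB
      obtain rfl := I.maxSets_eq hAm (hm j hj.le) (hBA hvB) hvj
      exact hBA.trans (node_subset_blossomSet hij hj)
    intro A hA B hB v hvA hvB
    rcases Finset.mem_insert.1 hA with rfl | hA <;> rcases Finset.mem_insert.1 hB with rfl | hB
    · exact Or.inl subset_rfl
    · exact Or.inr (key B hB v hvA hvB)
    · exact Or.inl (key A hA v hvB hvA)
    · exact I.laminar A hA B hB v hvA hvB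
  · -- An edge that leaves the blossom now joins the new set to the other end.
    have key : ∀ e ∈ s.M \ (blossom P i).edges, ∀ A B, s.Link G w e A B →
        ∀ j, i ≤ j → j < P.len → A = P.node j →
          State.Link G w ⟨s.M \ (blossom P i).edges, insert (blossomSet P i) s.Ω, s.π,
            Function.update s.circ (blossomSet P i) (some (blossom P i))⟩ e (blossomSet P i) B := by
      rintro e he A B h j hij hj rfl
      have hB : ∀ k, i ≤ k → k < P.len → B ≠ P.node k := by
        rintro k hik hk rfl
        have e1 := hbase e he j hij hj h.joins.touches_left
        have e2 := hbase e he k hik hk h.joins.touches_right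
        exact h.2.2.2.2.1 (by rw [e1, e2])
      refine ⟨h.1, h.2.1, blossomSet_mem_maxSets hP rfl,
        I.maxSets_of_shrink hP rfl h.2.2.2.1 hB, ?_,
        h.joins.mono (node_subset_blossomSet hij hj) subset_rfl⟩
      rintro rfl
      obtain ⟨v, hv⟩ := I.nonempty (hm j hj.le).prop
      exact h.2.2.2.2.1
        (I.maxSets_eq h.2.2.1 h.2.2.2.1 hv (node_subset_blossomSet hij hj hv))
    intro e he
    obtain ⟨A, B, h⟩ := I.link e (Finset.mem_sdiff.1 he).1
    by_cases hAb : ∃ j, i ≤ j ∧ j < P.len ∧ A = P.node j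
    · obtain ⟨j, hij, hj, hA⟩ := hAb
      exact ⟨_, _, key e he A B h j hij hj hA⟩
    by_cases hBb : ∃ j, i ≤ j ∧ j < P.len ∧ B = P.node j
    · obtain ⟨j, hij, hj, hB⟩ := hBb
      exact ⟨_, _, key e he B A h.symm j hij hj hB⟩
    push Not at hAb hBb
    exact ⟨A, B, h.1, h.2.1, I.maxSets_of_shrink hP rfl h.2.2.1 hAb,
      I.maxSets_of_shrink hP rfl h.2.2.2.1 hBb, h.2.2.2.2⟩
  · intro e he f hf A hAm hte htf
    have heM := (Finset.mem_sdiff.1 he).1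
    have hfM := (Finset.mem_sdiff.1 hf).1
    rcases maxSets_shrink rfl hAm with rfl | ⟨hAs, -⟩
    · exact I.unique e heM f hfM _ (hm i hi.le) (hU e he hte) (hU f hf htf)
    · exact I.unique e heM f hfM A hAs hte htf
  · intro W hW h3
    by_cases hWU : W = blossomSet P i
    · subst hWU
      exact ⟨_, Function.update_self .., hcirc⟩
    · have hWΩ := (Finset.mem_insert.1 hW).resolve_left hWU
      obtain ⟨C, hC, c⟩ := I.circ W hWΩ h3
      refine ⟨C, by simpa [Function.update_of_ne hWU] using hC,
        { c with
          mem := fun j hj => Finset.mem_insert_of_mem (c.mem j hj)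
          cover := ?_ }⟩
      intro W' hW' hlt
      rcases Finset.mem_insert.1 hW' with rfl | hW'
      · exfalso
        have h1 := node_subset_blossomSet (P := P) le_rfl hi
        have := eq_of_maxSets_subset (hm i hi.le) hWΩ (h1.trans hlt.subset)
        rw [this] at hlt
        exact hlt.not_subset h1
      · exact c.cover W' hW' hlt

/-! ### Deshrinking -/

/-- The alternate edges of an odd circuit, starting after the node with index `k`, form a perfect
matching of the circuit minus that node. -/
theorem IsCircuitFor.exists_isNearPerfect {Ω : Finset (Finset V)} {π : Finset V → ℝ} {C : Walk V}
    {U : Finset V} (c : IsCircuitFor G w Ω π C U) {k : ℕ} (hk : k < C.len) :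
    ∃ N, IsNearPerfect C (C.node k) N := by
  classical
  -- `p i` says that the distance from `k` to `i` along the circuit is odd.
  let p : ℕ → Prop := fun i => (k < i ∧ (i - k) % 2 = 1) ∨ (i < k ∧ (k - i) % 2 = 0)
  have hodd := Nat.odd_iff.1 c.odd_len
  refine ⟨((Finset.range C.len).filter p).image C.edge, ?_, ?_, ?_⟩
  · exact Finset.image_subset_image (Finset.filter_subset _ _)
  · intro e he ht
    obtain ⟨i, hi, rfl⟩ := Finset.mem_image.1 he
    simp only [Finset.mem_filter, Finset.mem_range, p] at hi
    have := (c.touches_iff hi.1 hk).1 ht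
    omega
  · intro j hj hne
    have hjk : j ≠ k := by
      rintro rfl
      exact hne rfl
    have hex : ∃ i < C.len, p i ∧ (j = i ∨ j = i + 1 ∨ i + 1 = C.len ∧ j = 0) := by
      by_cases hpj : p j
      · exact ⟨j, hj, hpj, Or.inl rfl⟩
      · simp only [p] at hpj ⊢
        rcases Nat.eq_zero_or_pos j with rfl | hpos
        · exact ⟨C.len - 1, by omega, by omega, by omega⟩
        · exact ⟨j - 1, by omega, by omega, by omega⟩
    obtain ⟨i, hi, hpi, hij⟩ := hex
    refine ⟨C.edge i, ⟨Finset.mem_image.2 ⟨i, by simp [hi, hpi], rfl⟩,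
      (c.touches_iff hi hj).2 hij⟩, ?_⟩
    rintro f ⟨hf, htf⟩
    obtain ⟨i', hi', rfl⟩ := Finset.mem_image.1 hf
    simp only [Finset.mem_filter, Finset.mem_range] at hi'
    have h' := (c.touches_iff hi'.1 hj).1 htf
    have hpi' := hi'.2
    have hlt := hi'.1
    simp only [p] at hpi hpi'
    have : i' = i := by omega
    rw [this]

/-- After deshrinking `U`, the nodes of its circuit take the place of `U` among the maximal
sets. -/
theorem Invariant.mem_maxSets_deshrink_iff (I : Invariant G w s) {U : Finset V} {C : Walk V}
    (hU : U ∈ s.maxSets) (c : IsCircuitFor G w s.Ω s.π C U) {t : State V}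
    (ht : t.Ω = s.Ω.erase U) {A : Finset V} :
    A ∈ t.maxSets ↔ (A ∈ s.maxSets ∧ A ≠ U) ∨ ∃ j < C.len, A = C.node j := by
  have hmem : ∀ W, W ∈ t.Ω ↔ W ≠ U ∧ W ∈ s.Ω := fun W => by rw [ht, Finset.mem_erase]
  constructor
  · intro hA
    obtain ⟨hne, hAΩ⟩ := (hmem A).1 hA.prop
    by_cases hAU : A ⊆ U
    · obtain ⟨j, hj, hAj⟩ := c.cover A hAΩ (hAU.ssubset_of_ne hne)
      exact Or.inr ⟨j, hj, (eq_of_maxSets_subset hA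
        ((hmem _).2 ⟨c.ne_self j hj, c.mem j hj⟩) hAj).symm⟩
    · refine Or.inl ⟨⟨hAΩ, fun W hW hAW => ?_⟩, hne⟩
      refine (eq_of_maxSets_subset hA ((hmem W).2 ⟨?_, hW⟩) hAW).le
      rintro rfl
      exact hAU hAW
  · rintro (⟨hA, hne⟩ | ⟨j, hj, rfl⟩)
    · exact ⟨(hmem A).2 ⟨hne, hA.prop⟩, fun W hW hAW =>
        (eq_of_maxSets_subset hA ((hmem W).1 hW).2 hAW).le⟩
    · refine ⟨(hmem _).2 ⟨c.ne_self j hj, c.mem j hj⟩, fun W hW hjW => ?_⟩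
      obtain ⟨hWU, hWΩ⟩ := (hmem W).1 hW
      obtain ⟨v, hv⟩ := I.nonempty (c.mem j hj)
      have hvW : v ∈ W := hjW hv
      have hvU : v ∈ U := c.node_subset hj hv
      have hsub : W ⊆ U := by
        rcases I.laminar W hWΩ U hU.prop v hvW hvU with h | h
        · exact h
        · exact (eq_of_maxSets_subset hU hWΩ h).le
      obtain ⟨i, hi, hWi⟩ := c.cover W hWΩ (hsub.ssubset_of_ne hWU)
      rwa [c.disj j hj i hi v hv (hWi hvW)]

theorem Invariant.deshrink (I : Invariant G w s) {U : Finset V} {t : State V}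
    (h : Deshrink s U t) : Invariant G w t := by
  obtain ⟨hU, h3, C, k, N, hC, hk, hcov, hN, rfl⟩ := h
  obtain ⟨C', hC', c⟩ := I.circ U hU.prop h3
  obtain rfl : C = C' := by rw [hC] at hC'; exact Option.some.inj hC'
  have hmax : ∀ A : Finset V, A ∈ ({ s with M := s.M ∪ N, Ω := s.Ω.erase U } : State V).maxSets ↔
      (A ∈ s.maxSets ∧ A ≠ U) ∨ ∃ j < C.len, A = C.node j :=
    fun A => I.mem_maxSets_deshrink_iff hU c rfl
  refine ⟨?_, ?_, ?_, ?_, ?_, ?_⟩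
  · intro v
    refine Finset.mem_erase.2 ⟨?_, I.singleton_mem v⟩
    rintro rfl
    simp at h3
  · exact fun W hW => I.odd W (Finset.mem_of_mem_erase hW)
  · exact fun A hA B hB => I.laminar A (Finset.mem_of_mem_erase hA) B (Finset.mem_of_mem_erase hB)
  · intro e he
    rcases Finset.mem_union.1 he with he | he
    · have key : ∀ B, s.Link G w e U B →
          State.Link G w { s with M := s.M ∪ N, Ω := s.Ω.erase U } e (C.node k) B := by
        intro B h
        have hd := I.maxSets_disjoint hU h.2.2.2.1 h.2.2.2.2.1
        have htk := hcov e he h.joins.touches_left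
        refine ⟨h.1, h.2.1, (hmax _).2 (Or.inr ⟨k, hk, rfl⟩),
          (hmax _).2 (Or.inl ⟨h.2.2.2.1, h.2.2.2.2.1.symm⟩), ?_, ?_⟩
        · rintro rfl
          exact c.ne_self k hk (eq_of_maxSets_subset h.2.2.2.1 hU.prop (c.node_subset hk)).symm
        · obtain ⟨a, ha, b, hb, rfl⟩ := h.joins
          obtain ⟨v, hv, hvk⟩ := htk
          rcases Sym2.mem_iff.1 hv with rfl | rfl
          · exact ⟨_, hvk, b, hb, rfl⟩
          · exact absurd hb (Finset.disjoint_left.1 hd (c.node_subset hk hvk))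
      obtain ⟨A, B, h⟩ := I.link e he
      by_cases hA : A = U
      · subst hA
        exact ⟨_, _, key B h⟩
      by_cases hB : B = U
      · subst hB
        exact ⟨_, _, key A h.symm⟩
      exact ⟨A, B, h.1, h.2.1, (hmax A).2 (Or.inl ⟨h.2.2.1, hA⟩),
        (hmax B).2 (Or.inl ⟨h.2.2.2.1, hB⟩), h.2.2.2.2⟩
    · obtain ⟨i, hi, rfl⟩ := hN.exists_edge he
      obtain ⟨j, hj, hjn, -⟩ := c.node_succ hi
      exact ⟨C.node i, C.node (i + 1), c.edge_mem i hi, c.tight i hi,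
        (hmax _).2 (Or.inr ⟨i, hi, rfl⟩), (hmax _).2 (Or.inr ⟨j, hj, hjn⟩), c.ne i hi,
        c.joins i hi⟩
  · intro e he f hf A hA hte htf
    rcases (hmax A).1 hA with ⟨hAs, hAU⟩ | ⟨j, hj, rfl⟩
    · have hM : ∀ e ∈ s.M ∪ N, Touches e A → e ∈ s.M := by
        intro e he hte
        refine (Finset.mem_union.1 he).resolve_right fun he => ?_
        obtain ⟨i, hi, rfl⟩ := hN.exists_edge he
        exact I.not_touches_of_circuit hU c hi hAs hAU hte
      exact I.unique e (hM e he hte) f (hM f hf htf) A hAs hte htf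
    · by_cases hjk : j = k
      · subst hjk
        have hM : ∀ e ∈ s.M ∪ N, Touches e (C.node j) → e ∈ s.M := fun e he hte =>
          (Finset.mem_union.1 he).resolve_right fun he => hN.2.1 e he hte
        exact I.unique e (hM e he hte) f (hM f hf htf) U hU (hte.mono (c.node_subset hj))
          (htf.mono (c.node_subset hj))
      · have hM : ∀ e ∈ s.M ∪ N, Touches e (C.node j) → e ∈ N := fun e he hte =>
          (Finset.mem_union.1 he).resolve_left fun he =>
            hjk (I.eq_of_touches_node hU c hk hcov he hj hte)
        have hne : C.node j ≠ C.node k := by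
          intro h
          obtain ⟨v, hv⟩ := I.nonempty (c.mem j hj)
          exact hjk (c.disj j hj k hk v hv (h ▸ hv))
        exact (hN.2.2 j hj hne).unique ⟨hM e he hte, hte⟩ ⟨hM f hf htf, htf⟩
  · intro W hW hW3
    obtain ⟨hWU, hWΩ⟩ := Finset.mem_erase.1 hW
    obtain ⟨D, hD, d⟩ := I.circ W hWΩ hW3
    refine ⟨D, hD, { d with
      mem := fun j hj => Finset.mem_erase.2 ⟨?_, d.mem j hj⟩
      cover := fun W' hW' => d.cover W' (Finset.mem_of_mem_erase hW') }⟩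
    intro h
    have h1 := d.node_subset hj
    rw [h] at h1
    exact hWU (eq_of_maxSets_subset hU hWΩ h1)

/-- Deshrinking `U` preserves the number of exposed nodes: if `U` is exposed, the node of its
circuit that is left out takes its place. -/
theorem Invariant.ncard_exposed_deshrink (I : Invariant G w s) {U : Finset V} {t : State V}
    (h : Deshrink s U t) : t.exposed.ncard = s.exposed.ncard := by
  obtain ⟨hU, h3, C, k, N, hC, hk, hcov, hN, rfl⟩ := h
  obtain ⟨C', hC', c⟩ := I.circ U hU.prop h3
  obtain rfl : C = C' := by rw [hC] at hC'; exact Option.some.inj hC'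
  have hmax : ∀ A : Finset V, A ∈ ({ s with M := s.M ∪ N, Ω := s.Ω.erase U } : State V).maxSets ↔
      (A ∈ s.maxSets ∧ A ≠ U) ∨ ∃ j < C.len, A = C.node j :=
    fun A => I.mem_maxSets_deshrink_iff hU c rfl
  have hkmax : C.node k ∉ s.maxSets := fun h =>
    c.ne_self k hk (eq_of_maxSets_subset h hU.prop (c.node_subset hk)).symm
  let f : Finset V → Finset V := fun A => if A = U then C.node k else A
  have himg : ({ s with M := s.M ∪ N, Ω := s.Ω.erase U } : State V).exposed
      = f '' s.exposed := by
    ext A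
    constructor
    · rintro ⟨hA, hexp⟩
      rcases (hmax A).1 hA with ⟨hAs, hAU⟩ | ⟨j, hj, rfl⟩
      · exact ⟨A, ⟨hAs, fun e he => hexp e (Finset.mem_union_left _ he)⟩, by simp [f, hAU]⟩
      · have hjk : C.node j = C.node k := by
          by_contra hne
          obtain ⟨e, ⟨he, hte⟩, -⟩ := hN.2.2 j hj hne
          exact hexp e (Finset.mem_union_right _ he) hte
        rw [hjk] at hexp
        exact ⟨U, ⟨hU, fun e he ht => hexp e (Finset.mem_union_left _ he) (hcov e he ht)⟩,
          by simp [f, hjk]⟩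
    · rintro ⟨A, ⟨hA, hexp⟩, rfl⟩
      by_cases hAU : A = U
      · subst hAU
        simp only [f, if_true]
        refine ⟨(hmax _).2 (Or.inr ⟨k, hk, rfl⟩), fun e he ht => ?_⟩
        rcases Finset.mem_union.1 he with he | he
        · exact hexp e he (ht.mono (c.node_subset hk))
        · exact hN.2.1 e he ht
      · simp only [f, hAU, if_false]
        refine ⟨(hmax _).2 (Or.inl ⟨hA, hAU⟩), fun e he ht => ?_⟩
        rcases Finset.mem_union.1 he with he | he
        · exact hexp e he ht
        · obtain ⟨i, hi, rfl⟩ := hN.exists_edge he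
          exact I.not_touches_of_circuit hU c hi hA hAU ht
  rw [himg]
  refine Set.InjOn.ncard_image ?_
  intro A hA B hB hAB
  simp only [f] at hAB
  split_ifs at hAB with h1 h2 h2
  · rw [h1, h2]
  · exact absurd (hAB ▸ hB.1) hkmax
  · exact absurd (hAB ▸ hA.1) hkmax
  · exact hAB

theorem Invariant.exists_deshrink (I : Invariant G w s) {U : Finset V} (hU : U ∈ s.maxSets)
    (h3 : 3 ≤ U.card) : ∃ t, Deshrink s U t := by
  obtain ⟨C, hC, c⟩ := I.circ U hU.prop h3
  have hk : ∃ k < C.len, ∀ e ∈ s.M, Touches e U → Touches e (C.node k) := by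
    by_cases hex : ∃ e ∈ s.M, Touches e U
    · obtain ⟨e, he, ht⟩ := hex
      obtain ⟨v, hve, hvU⟩ := ht
      obtain ⟨k, hk, hvk⟩ := (c.mem_iff v).1 hvU
      refine ⟨k, hk, fun f hf htf => ?_⟩
      rw [I.unique f hf e he U hU htf ⟨v, hve, hvU⟩]
      exact ⟨v, hve, hvk⟩
    · push Not at hex
      exact ⟨0, c.odd_len.pos, fun e he ht => absurd ht (hex e he)⟩
  obtain ⟨k, hk, hcov⟩ := hk
  obtain ⟨N, hN⟩ := c.exists_isNearPerfect hk
  exact ⟨_, hU, h3, C, k, N, hC, hk, hcov, hN, rfl⟩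

theorem Invariant.exists_isExpansion (I : Invariant G w s) : ∃ N, IsExpansion s N := by
  induction hn : s.Ω.card using Nat.strong_induction_on generalizing s with
  | _ n ih =>
    by_cases hall : ∀ U ∈ s.Ω, U.card = 1
    · exact ⟨s.M, s, Relation.ReflTransGen.refl, hall, rfl⟩
    · push Not at hall
      obtain ⟨U, hU, hU1⟩ := hall
      obtain ⟨A, hA, hUA⟩ := exists_maxSets_of_mem hU
      have h3 : 3 ≤ A.card := by
        have h1 := Nat.odd_iff.1 (I.odd U hU)
        have h2 := Finset.card_le_card hUA
        have h4 := Nat.odd_iff.1 (I.odd A hA.prop)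
        omega
      obtain ⟨t, ht⟩ := I.exists_deshrink hA h3
      have hlt : t.Ω.card < n := by
        obtain ⟨-, -, C, k, N, -, -, -, -, rfl⟩ := ht
        rw [← hn]
        exact Finset.card_erase_lt_of_mem hA.prop
      obtain ⟨N, t', h1, h2⟩ := ih _ hlt (I.deshrink ht) rfl
      exact ⟨N, t', Relation.ReflTransGen.head ⟨A, ht⟩ h1, h2⟩

theorem Invariant.of_deshrinks (I : Invariant G w s) {t : State V}
    (h : Relation.ReflTransGen (fun a b => ∃ U, Deshrink a U b) s t) :
    Invariant G w t ∧ t.exposed.ncard = s.exposed.ncard := by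
  induction h with
  | refl => exact ⟨I, rfl⟩
  | tail _ h ih =>
    obtain ⟨U, hU⟩ := h
    exact ⟨ih.1.deshrink hU, (ih.1.ncard_exposed_deshrink hU).trans ih.2⟩

theorem Invariant.step (I : Invariant G w s) {t : State V} (h : Step G w s t) :
    Invariant G w t := by
  cases h with
  | augment P hP hp => exact I.augment hP hp
  | shrink P i hP => exact I.shrink hP
  | dual _ α hX hno hα hdes hall =>
    exact ((I.shiftDual hno α).of_deshrinks
      (hdes.lift id fun _ _ ⟨U, _, hU⟩ => ⟨U, hU⟩)).1

theorem Reachable.invariant (h : Reachable G w s) : Invariant G w s := by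
  induction h with
  | refl => exact invariant_initial
  | tail _ h ih => exact ih.step h

end Steps

/-! ### Counting uncovered vertices -/

theorem touches_singleton {e : Sym2 V} {v : V} : Touches e {v} ↔ v ∈ e := by
  simp [Touches]

/-- The ends of the edges in a part `F` of a matching are `2 |F|` in number. -/
theorem IsMatching.card_eq_two_mul {G : SimpleGraph V} {N : Finset (Sym2 V)} (hN : IsMatching G N)
    {A : Finset V} {F : Finset (Sym2 V)} (hF : F ⊆ N) (hA : ∀ v, v ∈ A ↔ ∃ e ∈ F, v ∈ e) :
    A.card = 2 * F.card := by
  classical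
  have hAF : A = F.biUnion Sym2.toFinset := by
    ext v
    simp [hA]
  rw [hAF, Finset.card_biUnion, Finset.sum_congr rfl, Finset.sum_const, smul_eq_mul, mul_comm]
  · intro e he
    exact Sym2.card_toFinset_of_not_isDiag e (G.not_isDiag_of_mem_edgeSet (hN.1 e (hF he)))
  · intro e he f hf hef
    refine Finset.disjoint_left.2 fun v hv hv' => hef ?_
    exact hN.2 e (hF he) f (hF hf) v (Sym2.mem_toFinset.1 hv) (Sym2.mem_toFinset.1 hv')

section Counting

variable [Fintype V] {G : SimpleGraph V} {w : Sym2 V → ℝ} {s : State V}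

open Classical in
/-- The vertices that no edge of `N` covers. -/
noncomputable def uncovered (N : Finset (Sym2 V)) : Finset V :=
  Finset.univ.filter fun v => ∀ e ∈ N, v ∉ e

theorem mem_uncovered {N : Finset (Sym2 V)} {v : V} : v ∈ uncovered N ↔ ∀ e ∈ N, v ∉ e := by
  simp [uncovered]

theorem IsMatching.two_mul_card_add {N : Finset (Sym2 V)} (hN : IsMatching G N) :
    2 * N.card + (uncovered N).card = Fintype.card V := by
  classical
  rw [← hN.card_eq_two_mul (A := (uncovered N)ᶜ) subset_rfl, Finset.card_compl_add_card]
  intro v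
  simp [mem_uncovered]

/-- A matching leaves a vertex of an odd set uncovered or covers one by an edge leaving the set. -/
theorem IsMatching.exists_of_odd {N : Finset (Sym2 V)} (hN : IsMatching G N) {A : Finset V}
    (hA : Odd A.card) :
    ∃ v ∈ A, v ∈ uncovered N ∨ ∃ u, s(v, u) ∈ N ∧ u ∉ A := by
  classical
  by_contra! hcon
  refine Nat.not_even_iff_odd.2 hA ?_
  rw [hN.card_eq_two_mul (F := N.filter fun e => ∀ x ∈ e, x ∈ A) (Finset.filter_subset _ _)]
  · exact even_two_mul _
  · intro v
    constructor
    · intro hv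
      obtain ⟨h1, h2⟩ := hcon v hv
      rw [mem_uncovered] at h1
      push Not at h1
      obtain ⟨e, he, hve⟩ := h1
      obtain ⟨u, rfl⟩ := Sym2.mem_iff_exists.1 hve
      refine ⟨_, Finset.mem_filter.2 ⟨he, fun x hx => ?_⟩, hve⟩
      rcases Sym2.mem_iff.1 hx with rfl | rfl
      · exact hv
      · exact h2 _ he
    · rintro ⟨e, he, hve⟩
      exact (Finset.mem_filter.1 he).2 v hve

/-! ### Optimality -/

/-- If the step size is unbounded, no shrunken set may be decreased. -/
theorem Invariant.card_eq_one_of_mem_oddReach (I : Invariant G w s)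
    (h : AssertsNoPerfectMatching G w s) {U : Finset V} (hU : U ∈ s.oddReach G w) :
    U.card = 1 := by
  obtain ⟨-, hno, hunb⟩ := h
  have hodd := I.odd U (mem_of_maxSets hU.1)
  by_contra hne
  have h3 : 3 ≤ U.card := by
    have := Nat.odd_iff.1 hodd
    omega
  refine hunb ⟨s.π U, fun α hα => ?_⟩
  have := hα.1 U hodd h3
  rw [shiftDual_eq, dualSlope_of_mem_oddReach hno hU] at this
  linarith

/-- If the step size is unbounded, every edge that leaves an evenly reached node, tight or not,
ends in an oddly reached one. -/
theorem Invariant.exists_oddReach_of_edge (I : Invariant G w s)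
    (h : AssertsNoPerfectMatching G w s) {A : Finset V} (hA : A ∈ s.evenReach G w) {v u : V}
    (he : s(v, u) ∈ G.edgeSet) (hv : v ∈ A) (hu : u ∉ A) : {u} ∈ s.oddReach G w := by
  obtain ⟨B, hB, huB⟩ := I.exists_maxSets u
  have hBS : B ∈ s.oddReach G w := by
    obtain ⟨-, hno, hunb⟩ := h
    by_contra hBS
    have hAB : A ≠ B := by
      rintro rfl
      exact hu huB
    have hJ : Joins s(v, u) A B := ⟨v, hv, u, huB, rfl⟩
    refine hunb ⟨max 0 (w s(v, u) - cutSum s.π s(v, u)), fun α hα => ?_⟩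
    have h1 := hα.2 _ he
    rw [I.cutSum_shiftDual_of_joins α hJ hA.1 hB hAB, dualSlope_of_mem_evenReach hno hA] at h1
    have h2 := dualSlope_nonneg hBS
    rcases le_total α 0 with h0 | h0
    · exact h0.trans (le_max_left _ _)
    · refine le_trans ?_ (le_max_right _ _)
      nlinarith [mul_nonneg h0 h2]
  obtain ⟨b, rfl⟩ := Finset.card_eq_one.1 (I.card_eq_one_of_mem_oddReach h hBS)
  rw [Finset.mem_singleton] at huB
  rwa [huB]

/-- Each oddly reached node has a mate, which is evenly reached and not exposed. -/
theorem Invariant.ncard_exposed_add_le (I : Invariant G w s)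
    (hno : ∀ P : Walk V, ¬ s.IsXXWalk G w P) :
    s.exposed.ncard + (s.oddReach G w).ncard ≤ (s.evenReach G w).ncard := by
  have hmate : ∀ A ∈ s.oddReach G w, ∃ B e, e ∈ s.M ∧ s.Link G w e A B := by
    intro A hA
    have hne : A ∉ s.exposed := fun h =>
      not_mem_evenReach_of_mem_oddReach hno hA (I.exposed_subset_evenReach h)
    have : ∃ e ∈ s.M, Touches e A := by
      by_contra! hcon
      exact hne ⟨hA.1, hcon⟩
    obtain ⟨e, he, ht⟩ := this
    obtain ⟨B, hB⟩ := I.link_of_touches he hA.1 ht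
    exact ⟨B, e, he, hB⟩
  choose! m e heM hlink using hmate
  rw [← Set.ncard_sdiff_add_ncard_of_subset I.exposed_subset_evenReach, add_comm]
  refine Nat.add_le_add_right (Set.ncard_le_ncard_of_injOn m ?_ ?_) _
  · intro A hA
    have hl := hlink A hA
    exact ⟨I.mem_evenReach_of_link (heM A hA) hl hA, fun h =>
      h.2 _ (heM A hA) hl.joins.touches_right⟩
  · intro A hA B hB hAB
    have h1 := (hlink A hA).symm
    have h2 := (hlink B hB).symm
    rw [← hAB] at h2
    rw [I.unique _ (heM B hB) _ (heM A hA) _ h1.2.2.1 h2.joins.touches_left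
      h1.joins.touches_left] at h2
    exact (I.link_right_unique h1 h2).symm

/-- The evenly reached nodes are odd sets all of whose leaving edges end in oddly reached
vertices. So a matching either leaves a vertex of such a set uncovered or uses up an oddly reached
vertex for it. -/
theorem Invariant.ncard_evenReach_le (I : Invariant G w s) (h : AssertsNoPerfectMatching G w s)
    {N : Finset (Sym2 V)} (hN : IsMatching G N) :
    (s.evenReach G w).ncard ≤ (uncovered N).card + (s.oddReach G w).ncard := by
  have : Nonempty V := by
    obtain ⟨U, hU⟩ := h.1
    exact (I.nonempty (mem_of_maxSets hU.1)).to_type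
  have hex : ∀ A ∈ s.evenReach G w, ∃ x : V, (x ∈ uncovered N ∧ x ∈ A) ∨
      (x ∉ uncovered N ∧ {x} ∈ s.oddReach G w ∧ ∃ v ∈ A, s(v, x) ∈ N) := by
    intro A hA
    obtain ⟨v, hv, hunc | ⟨u, he, hu⟩⟩ := hN.exists_of_odd (I.odd A (mem_of_maxSets hA.1))
    · exact ⟨v, Or.inl ⟨hunc, hv⟩⟩
    · refine ⟨u, Or.inr ⟨fun h' => mem_uncovered.1 h' _ he (by simp),
        I.exists_oddReach_of_edge h hA (hN.1 _ he) hv hu, v, hv, he⟩⟩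
  choose! f hf using hex
  have hsub : f '' s.evenReach G w ⊆ ↑(uncovered N) ∪ {x : V | {x} ∈ s.oddReach G w} := by
    rintro _ ⟨A, hA, rfl⟩
    rcases hf A hA with ⟨h1, -⟩ | ⟨-, h2, -⟩
    · exact Or.inl h1
    · exact Or.inr h2
  have hinj : Set.InjOn f (s.evenReach G w) := by
    intro A hA B hB hAB
    rcases hf A hA with ⟨h1, h2⟩ | ⟨h1, -, v, hv, hvN⟩ <;>
      rcases hf B hB with ⟨h3, h4⟩ | ⟨h3, -, v', hv', hvN'⟩
    · exact I.maxSets_eq hA.1 hB.1 h2 (hAB ▸ h4)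
    · exact absurd (hAB ▸ h1) h3
    · exact absurd (hAB ▸ h3) h1
    · rw [← hAB] at hvN'
      have := Sym2.congr_left.1 (hN.2 _ hvN _ hvN' (f A) (by simp) (by simp))
      subst this
      exact I.maxSets_eq hA.1 hB.1 hv hv'
  calc (s.evenReach G w).ncard = (f '' s.evenReach G w).ncard := hinj.ncard_image.symm
    _ ≤ _ := Set.ncard_le_ncard hsub
    _ ≤ _ := Set.ncard_union_le _ _
    _ ≤ _ := by
      rw [Set.ncard_coe_finset]
      refine Nat.add_le_add_left ?_ _
      exact Set.ncard_le_ncard_of_injOn (fun x => {x}) (fun x hx => hx)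
        fun x _ y _ hxy => Finset.singleton_injective hxy

theorem Invariant.ncard_exposed_le (I : Invariant G w s) (h : AssertsNoPerfectMatching G w s)
    {N : Finset (Sym2 V)} (hN : IsMatching G N) : s.exposed.ncard ≤ (uncovered N).card := by
  have h1 := I.ncard_exposed_add_le h.2.1
  have h2 := I.ncard_evenReach_le h hN
  omega

theorem Invariant.singleton_mem_maxSets (I : Invariant G w s) (h1 : ∀ U ∈ s.Ω, U.card = 1)
    (v : V) : {v} ∈ s.maxSets := by
  obtain ⟨A, hA, hvA⟩ := I.exists_maxSets v
  obtain ⟨a, rfl⟩ := Finset.card_eq_one.1 (h1 A hA.prop)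
  rw [Finset.mem_singleton] at hvA
  rwa [hvA]

/-- Without shrunken sets, the graph `G'` is a spanning subgraph of `G`. -/
theorem Invariant.isMatching (I : Invariant G w s) (h1 : ∀ U ∈ s.Ω, U.card = 1) :
    IsMatching G s.M := by
  refine ⟨fun e he => ?_, fun e he f hf v hve hvf => ?_⟩
  · obtain ⟨A, B, h⟩ := I.link e he
    exact h.1
  · exact I.unique e he f hf _ (I.singleton_mem_maxSets h1 v) (touches_singleton.2 hve)
      (touches_singleton.2 hvf)

theorem Invariant.ncard_exposed_eq (I : Invariant G w s) (h1 : ∀ U ∈ s.Ω, U.card = 1) :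
    s.exposed.ncard = (uncovered s.M).card := by
  have : s.exposed = (fun v : V => ({v} : Finset V)) '' ↑(uncovered s.M) := by
    ext A
    constructor
    · rintro ⟨hA, hexp⟩
      obtain ⟨a, rfl⟩ := Finset.card_eq_one.1 (h1 A hA.prop)
      exact ⟨a, mem_uncovered.2 fun e he ha => hexp e he (touches_singleton.2 ha), rfl⟩
    · rintro ⟨a, ha, rfl⟩
      exact ⟨I.singleton_mem_maxSets h1 a, fun e he ht =>
        mem_uncovered.1 ha e he (touches_singleton.1 ht)⟩
  rw [this, Set.ncard_image_of_injective _ Finset.singleton_injective, Set.ncard_coe_finset]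

end Counting

end EdmondsMatching

theorem mainTheorem2 {V : Type*} [Fintype V] [DecidableEq V] (G : SimpleGraph V)
    (w : Sym2 V → ℝ) (hw : ∀ e ∈ G.edgeSet, 0 ≤ w e)
    (s : EdmondsMatching.State V) (hs : EdmondsMatching.Reachable G w s)
    (hassert : EdmondsMatching.AssertsNoPerfectMatching G w s) :
    (∃ N : Finset (Sym2 V), EdmondsMatching.IsExpansion s N) ∧
      ∀ N : Finset (Sym2 V), EdmondsMatching.IsExpansion s N →
        EdmondsMatching.IsMatching G N ∧ N.card = EdmondsMatching.matchingNumber G := by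
  classical
  have I := hs.invariant
  refine ⟨I.exists_isExpansion, ?_⟩
  rintro N ⟨t, hst, ht1, rfl⟩
  obtain ⟨It, hexp⟩ := I.of_deshrinks hst
  have hM := It.isMatching ht1
  refine ⟨hM, le_antisymm ?_ (Finset.sup_le fun N' hN' => ?_)⟩
  · exact Finset.le_sup (f := Finset.card) (Finset.mem_filter.2 ⟨Finset.mem_univ _, hM⟩)
  · have hN := (Finset.mem_filter.1 hN').2
    have h1 := I.ncard_exposed_le hassert hN
    have h2 := hN.two_mul_card_add
    have h3 := hM.two_mul_card_add
    have h4 := It.ncard_exposed_eq ht1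
    omega
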